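/- Let $M$ be a connected complex manifold of dimension 2 and let $F:T'M\to[0,\infty)$ be a complex Finsler metric on its holomorphic tangent bundle: $F$ is continuous, $L=F^2$ is smooth on $T'M\setminus\{0\}$, $F(z,\eta)=0$ iff $\eta=0$, $F(z,\lambda\eta)=|\lambda|F(z,\eta)$ for $\lambda\in\mathbb C$, and in all local holomorphic coordinates $(z^k,\eta^k)$ the Hermitian matrix $g_{i\bar j}=\partial^2L/\partial\eta^i\partial\bar\eta^j$ is positive definite on $T'M\setminus\{0\}$. Write $(g^{\bar j i})$ for its inverse, $\dot\partial_k=\partial/\partial\eta^k$, $N^k_j=g^{\bar mk}\frac{\partial g_{l\bar m}}{\partial z^j}\eta^l$, $\delta_k=\partial/\partial z^k-N^j_k\dot\partial_j$, $\delta_{\bar k}=\overline{\delta_k}$, and $$L^i_{jk}=g^{\bar li}\delta_kg_{j\bar l},\quad C^i_{jk}=g^{\bar li}\dot\partial_kg_{j\bar l},\quad R^i_{j\bar hk}=-\delta_{\bar h}L^i_{jk}-\delta_{\bar h}(N^l_k)\,C^i_{jl},\quad R_{\bar rj\bar hk}=g_{l\bar r}R^l_{j\bar hk}$$ (the Chern–Finsler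 connection and its $h\bar h$-Riemann type tensor). The local complex Berwald frame is given by $l^i=\eta^i/F$, $l_i=g_{i\bar j}l^{\bar j}$, $m^1=-l_2/\sqrt g$, $m^2=l_1/\sqrt g$, $m_i=g_{i\bar j}m^{\bar j}$, where $g=\det(g_{i\bar j})$, $l^{\bar j}=\overline{l^j}$, $m^{\bar j}=\overline{m^j}$. Put $A=m^jm^kl_hC^h_{kj}$, $B=m_hm^km^jC^h_{jk}$, $J=l^jl^kl_iL^i_{jk}$, $V=l^jm^kl_iL^i_{jk}$, $E=l^jm^km_iL^i_{jk}$, $H=m^jm^km_iL^i_{jk}$, and define the horizontal curvature invariants $$\mathbf K=-\tfrac1F(\delta_{\bar k}J)\bar\eta^k,\qquad \mathbf W=-(\delta_{\bar s}H)m^{\bar s}-\tfrac12H(\bar V+\bar H)-BF(\delta_{\bar s}E)m^{\bar s}.$$ **Theorem.** Suppose that 1. $(M,F)$ is a complex Berwald space, i.e. it is Kähler, $(L^i_{jk}-L^i_{kj})\eta^j=0$, and the functions $L^i_{jk}=L^i_{jk}(z)$ do not depend on $\eta$; 2. the weak symmetry condition $R_{\bar 0k\bar 00}=R_{\bar 00\bar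 0k}$ holds, i.e. $R_{\bar rk\bar hj}\bar\eta^r\bar\eta^h\eta^j=R_{\bar rj\bar hk}\bar\eta^r\bar\eta^h\eta^j$ for $k=1,2$; 3. $A$ does not vanish identically on $T'M\setminus\{0\}$, i.e. there are a chart and a point of $T'M\setminus\{0\}$ over it at which $A\neq0$. Then $R_{\bar rj\bar hk}=0$ everywhere on $T'M\setminus\{0\}$ (for all indices and in every chart), and in particular $\mathbf K=\mathbf W=0$ there. -/

import Mathlib

open scoped Manifold ContDiff ComplexOrder

noncomputable section

namespace CFinsler

/-- The coordinate space of a chart, and also the space of fibre coordinates. -/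
abbrev C2 := Fin 2 → ℂ

/-- Points `(z, η)` of the holomorphic tangent bundle in local coordinates. -/
abbrev Pt := C2 × C2

/-! ### Wirtinger derivatives in the variables `z` and `η` -/

/-- `∂/∂z^k`. -/
def dz (k : Fin 2) (u : Pt → ℂ) (p : Pt) : ℂ :=
  (1 / 2 : ℂ) * (fderiv ℝ u p (Pi.single k 1, 0)
    - Complex.I * fderiv ℝ u p (Pi.single k Complex.I, 0))

/-- `∂/∂z̄^k`. -/
def dzBar (k : Fin 2) (u : Pt → ℂ) (p : Pt) : ℂ :=
  (1 / 2 : ℂ) * (fderiv ℝ u p (Pi.single k 1, 0)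
    + Complex.I * fderiv ℝ u p (Pi.single k Complex.I, 0))

/-- `∂/∂η^k`. -/
def dv (k : Fin 2) (u : Pt → ℂ) (p : Pt) : ℂ :=
  (1 / 2 : ℂ) * (fderiv ℝ u p (0, Pi.single k 1)
    - Complex.I * fderiv ℝ u p (0, Pi.single k Complex.I))

/-- `∂/∂η̄^k`. -/
def dvBar (k : Fin 2) (u : Pt → ℂ) (p : Pt) : ℂ :=
  (1 / 2 : ℂ) * (fderiv ℝ u p (0, Pi.single k 1)
    + Complex.I * fderiv ℝ u p (0, Pi.single k Complex.I))

/-! ### Local geometry: `f (z, η)` is the fundamental function `F` in a chart -/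

section LocalGeometry

variable (f : Pt → ℝ)

/-- The fundamental tensor `g_{i j̄} = ∂²L / ∂η^i ∂η̄^j`, where `L = F²`. -/
def g (i j : Fin 2) : Pt → ℂ := dv i (dvBar j fun q => ((f q ^ 2 : ℝ) : ℂ))

/-- The matrix `(g_{i j̄})`. -/
def gMat (p : Pt) : Matrix (Fin 2) (Fin 2) ℂ := Matrix.of fun i j => g f i j p

/-- The inverse matrix: `gInv m k = g^{m̄ k}`, so that `∑ m, g_{l m̄} g^{m̄ k} = δ_l^k`. -/
def gInv (m k : Fin 2) (p : Pt) : ℂ := (gMat f p)⁻¹ m k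

/-- The Chern-Finsler nonlinear connection `N f k j = N_j^k = g^{m̄ k} (∂g_{l m̄} / ∂z^j) η^l`. -/
def N (k j : Fin 2) (p : Pt) : ℂ :=
  ∑ m, ∑ l, gInv f m k p * dz j (g f l m) p * p.2 l

/-- The horizontal derivation `δ_k = ∂/∂z^k - N_k^j ∂/∂η^j`. -/
def delta (k : Fin 2) (u : Pt → ℂ) (p : Pt) : ℂ :=
  dz k u p - ∑ j, N f j k p * dv j u p

/-- The conjugate derivation `δ_{k̄}`. -/
def deltaBar (k : Fin 2) (u : Pt → ℂ) (p : Pt) : ℂ :=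
  dzBar k u p - ∑ j, star (N f j k p) * dvBar j u p

/-- The horizontal Chern-Finsler coefficients `Lc f i j k = L^i_{jk} = g^{l̄ i} δ_k g_{j l̄}`. -/
def Lc (i j k : Fin 2) (p : Pt) : ℂ :=
  ∑ l, gInv f l i p * delta f k (g f j l) p

/-- The vertical Chern-Finsler coefficients `Cc f i j k = C^i_{jk} = g^{l̄ i} ∂g_{j l̄} / ∂η^k`. -/
def Cc (i j k : Fin 2) (p : Pt) : ℂ :=
  ∑ l, gInv f l i p * dv k (g f j l) p

/-- `Rup f i j h k = R^i_{j h̄ k} = -δ_{h̄} L^i_{jk} - δ_{h̄}(N_k^l) C^i_{jl}`. -/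
def Rup (i j h k : Fin 2) (p : Pt) : ℂ :=
  -deltaBar f h (Lc f i j k) p - ∑ l, deltaBar f h (N f l k) p * Cc f i j l p

/-- The `h h̄`-Riemann type tensor: `R f r j h k = R_{r̄ j h̄ k} = g_{l r̄} R^l_{j h̄ k}`. -/
def R (r j h k : Fin 2) (p : Pt) : ℂ :=
  ∑ l, g f l r p * Rup f l j h k p

/-! ### The local complex Berwald frame -/

/-- `l^i = η^i / F`. -/
def lUp (i : Fin 2) (p : Pt) : ℂ := p.2 i / (f p : ℂ)

/-- `l_i = g_{i j̄} l^{j̄}`. -/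
def lLo (i : Fin 2) (p : Pt) : ℂ := ∑ j, g f i j p * star (lUp f j p)

/-- `√g` with `g = det (g_{i j̄})`, a positive real number. -/
def sqrtDet (p : Pt) : ℂ := (Real.sqrt (gMat f p).det.re : ℂ)

/-- `(m^1, m^2) = (-l_2 / √g, l_1 / √g)`. -/
def mUp (i : Fin 2) (p : Pt) : ℂ :=
  (![-lLo f 1 p, lLo f 0 p] : Fin 2 → ℂ) i / sqrtDet f p

/-- `m_i = g_{i j̄} m^{j̄}`. -/
def mLo (i : Fin 2) (p : Pt) : ℂ := ∑ j, g f i j p * star (mUp f j p)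

/-- `A = m^j m^k l_h C^h_{kj}`. -/
def A (p : Pt) : ℂ :=
  ∑ j, ∑ k, ∑ h, mUp f j p * mUp f k p * lLo f h p * Cc f h k j p

/-- `B = m_h m^k m^j C^h_{jk}`. -/
def B (p : Pt) : ℂ :=
  ∑ h, ∑ k, ∑ j, mLo f h p * mUp f k p * mUp f j p * Cc f h j k p

/-- `J = l^j l^k l_i L^i_{jk}`. -/
def J (p : Pt) : ℂ :=
  ∑ i, ∑ j, ∑ k, lUp f j p * lUp f k p * lLo f i p * Lc f i j k p

/-- `V = l^j m^k l_i L^i_{jk}`. -/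
def V (p : Pt) : ℂ :=
  ∑ i, ∑ j, ∑ k, lUp f j p * mUp f k p * lLo f i p * Lc f i j k p

/-- `E = l^j m^k m_i L^i_{jk}`. -/
def E (p : Pt) : ℂ :=
  ∑ i, ∑ j, ∑ k, lUp f j p * mUp f k p * mLo f i p * Lc f i j k p

/-- `H = m^j m^k m_i L^i_{jk}`. -/
def H (p : Pt) : ℂ :=
  ∑ i, ∑ j, ∑ k, mUp f j p * mUp f k p * mLo f i p * Lc f i j k p

/-- The horizontal curvature invariant `𝐊 = -(1/F) J_{|0̄}`, where `J_{|0̄} = δ_{k̄}(J) η̄^k`. -/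
def K (p : Pt) : ℂ :=
  -(1 / (f p : ℂ)) * ∑ k, deltaBar f k (J f) p * star (p.2 k)

/-- The horizontal curvature invariant
`𝐖 = -H_{|s̄} m^{s̄} - ½ H (V̄ + H̄) - B F E_{|s̄} m^{s̄}`. -/
def W (p : Pt) : ℂ :=
  -(∑ s, deltaBar f s (H f) p * star (mUp f s p))
    - (1 / 2 : ℂ) * H f p * (star (V f p) + star (H f p))
    - B f p * (f p : ℂ) * ∑ s, deltaBar f s (E f) p * star (mUp f s p)

end LocalGeometry

/-! ### Complex Finsler spaces of dimension two -/

section Global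

variable {M : Type*} [TopologicalSpace M] [ChartedSpace C2 M] [IsManifold 𝓘(ℂ, C2) ω M]

/-- The expression of `F` in the chart `x`: the point with coordinates `(z, η)` is the tangent
vector `η^k ∂/∂z^k` at `x⁻¹(z)`. The holomorphic tangent bundle is the tangent bundle of `M`
as a complex manifold. -/
def loc (F : TangentBundle 𝓘(ℂ, C2) M → ℝ) (x : OpenPartialHomeomorph M C2) (p : Pt) : ℝ :=
  F (tangentMap 𝓘(ℂ, C2) 𝓘(ℂ, C2) x.symm ⟨p.1, p.2⟩)

/-- The coordinates of the nonzero tangent vectors over the domain of the chart `x`. -/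
def slit (x : OpenPartialHomeomorph M C2) : Set Pt := {p | p.1 ∈ x.target ∧ p.2 ≠ 0}

/-- All holomorphic charts of `M`. -/
abbrev charts (M : Type*) [TopologicalSpace M] [ChartedSpace C2 M] :
    Set (OpenPartialHomeomorph M C2) :=
  IsManifold.maximalAtlas 𝓘(ℂ, C2) ω M

/-- `(M, F)` is a (two-dimensional) complex Finsler space. -/
structure IsComplexFinsler (F : TangentBundle 𝓘(ℂ, C2) M → ℝ) : Prop where
  continuous : Continuous F
  smooth : ∀ x ∈ charts M, ContDiffOn ℝ ∞ (fun p => loc F x p ^ 2) (slit x)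
  nonneg : ∀ v, 0 ≤ F v
  eq_zero_iff : ∀ (z : M) (v : TangentSpace 𝓘(ℂ, C2) z), F ⟨z, v⟩ = 0 ↔ v = 0
  homogeneous : ∀ (z : M) (c : ℂ) (v : TangentSpace 𝓘(ℂ, C2) z), F ⟨z, c • v⟩ = ‖c‖ * F ⟨z, v⟩
  posDef : ∀ x ∈ charts M, ∀ p ∈ slit x, (gMat (loc F x) p).PosDef

/-- Kähler: `T^i_{jk} η^j = 0`, where `T^i_{jk} = L^i_{jk} - L^i_{kj}`. -/
def IsKahler (F : TangentBundle 𝓘(ℂ, C2) M → ℝ) : Prop :=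
  ∀ x ∈ charts M, ∀ p ∈ slit x, ∀ i k : Fin 2,
    ∑ j, (Lc (loc F x) i j k p - Lc (loc F x) i k j p) * p.2 j = 0

/-- Complex Berwald: Kähler, and `L^i_{jk} = L^i_{jk}(z)` does not depend on `η`. -/
def IsBerwald (F : TangentBundle 𝓘(ℂ, C2) M → ℝ) : Prop :=
  IsKahler F ∧ ∀ x ∈ charts M, ∀ p ∈ slit x, ∀ q ∈ slit x, p.1 = q.1 →
    ∀ i j k : Fin 2, Lc (loc F x) i j k p = Lc (loc F x) i j k q

/-- The weak symmetry condition `R_{0̄ k 0̄ 0} = R_{0̄ 0 0̄ k}`, where the index `0` is the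
contraction with `η` and `0̄` the contraction with `η̄`. -/
def IsWeaklySymmetric (F : TangentBundle 𝓘(ℂ, C2) M → ℝ) : Prop :=
  ∀ x ∈ charts M, ∀ p ∈ slit x, ∀ k : Fin 2,
    ∑ r, ∑ h, ∑ j, R (loc F x) r k h j p * star (p.2 r) * star (p.2 h) * p.2 j =
      ∑ r, ∑ h, ∑ j, R (loc F x) r j h k p * star (p.2 r) * star (p.2 h) * p.2 j

end Global

end CFinsler

end

noncomputable section

namespace CFinsler

open Complex

/-! ### Wirtinger calculus -/

/-! Write `L_k`, `L_{kl}` for the pure η-derivatives of `L`. For a Berwald metric `N^l_k =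
L^l_{mk}(z) η^m` is linear in η, and the whole tensor `R` is built from `P^l_{m s̄ k} =
-∂L^l_{mk}/∂z̄^s` (`Pc`), which depends on z alone and is symmetric in m, k (`R_eq`, `Pc_symm`). So
it suffices to find, on every fibre, one point where `P = 0`.

Weak symmetry supplies this wherever `L_{kl} ≠ 0`. By Euler's identities it reduces to `η̄^s Q^l_s
L_{lk} = 0` with `Q^l_s = P^l_{m s̄ j} η^m η^j` (`sum_Qc_L2`). A nonzero 2×2 matrix `L_{lk}` has a
one-dimensional kernel, spanned by η, so `η̄^s Q_s` is parallel to η; as `Q_s` is holomorphic in η,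
each `Q_s` is parallel to η (`wedge_Qc`). Comparing coefficients of a cubic gives `P^l_{m s̄ k} =
½(δ^l_m c_{sk} + δ^l_k c_{sm})` (`Pc_projective`). On the other hand `L` is horizontally constant,
and commuting `∂/∂z̄^s` with `∂/∂z^k` on `L` shows that `P^l_{m s̄ k} η^m L_l` is Hermitian in s, k
(`Yc_herm`). For the above form of `P` this makes `Φ = c_{sk} η̄^s η^k` real with `L ∂_kΦ = Φ L_k`:
if `Φ` were nonzero, `L` would be locally proportional to a Hermitian form and `L_{kl}` would
vanish. Hence `Φ = 0`, `c = 0` and `P = 0` (`Pc_eq_zero_of_nonQuad`).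

It remains to see that every fibre has a point with `L_{kl} ≠ 0`. If a fibre has none, its `g_{i
j̄}` is constant and `F²` is a Hermitian form there (`hermAt_of_L2_eq_zero`). Parallel transport of
a Berwald metric is a linear isometry between fibres, so being Hermitian is a locally constant
property of the base point (`eventually_hermAt_iff`), and by connectedness all fibres would be
Hermitian. That contradicts `A ≠ 0`, since `l_h C^h_{kj} = L_{kj}/F` (`A_eq_zero`).

Finally, when `P = 0` the coefficients `L^i_{jk}` and the frame vectors are eigenfunctions of
`δ_s̄`, and `K = W = 0` follows by adding eigenvalues. -/

/-- The Wirtinger derivative in the direction `w`: holomorphic for `σ = I`, antiholomorphic for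
`σ = -I`. -/
def wir (σ : ℂ) (w : Pt) (u : Pt → ℂ) (p : Pt) : ℂ :=
  (1 / 2 : ℂ) * (fderiv ℝ u p w - σ * fderiv ℝ u p (I • w))

/-- Horizontal coordinate directions. -/
def hdir (k : Fin 2) : Pt := (Pi.single k 1, 0)

/-- Vertical coordinate directions. -/
def vdir (k : Fin 2) : Pt := (0, Pi.single k 1)

lemma I_smul_hdir (k : Fin 2) : I • hdir k = (Pi.single k I, 0) := by
  simp [hdir, ← Pi.single_smul]

lemma I_smul_vdir (k : Fin 2) : I • vdir k = (0, Pi.single k I) := by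
  simp [vdir, ← Pi.single_smul]

lemma dz_eq_wir (k : Fin 2) : dz k = wir I (hdir k) := by
  funext u p; rw [dz, wir, I_smul_hdir]; rfl

lemma dzBar_eq_wir (k : Fin 2) : dzBar k = wir (-I) (hdir k) := by
  funext u p; rw [dzBar, wir, I_smul_hdir, hdir]; ring

lemma dv_eq_wir (k : Fin 2) : dv k = wir I (vdir k) := by
  funext u p; rw [dv, wir, I_smul_vdir]; rfl

lemma dvBar_eq_wir (k : Fin 2) : dvBar k = wir (-I) (vdir k) := by
  funext u p; rw [dvBar, wir, I_smul_vdir, vdir]; ring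

/-- `u` is smooth on the open set `S`. -/
structure Sm (S : Set Pt) (u : Pt → ℂ) : Prop where
  isOpen : IsOpen S
  contDiffOn : ContDiffOn ℝ ∞ u S

section Calculus

variable {S : Set Pt} {u v : Pt → ℂ} {p : Pt} {σ τ : ℂ} {w w' : Pt}

lemma Sm.contDiffAt (hu : Sm S u) (hp : p ∈ S) : ContDiffAt ℝ ∞ u p :=
  hu.contDiffOn.contDiffAt (hu.isOpen.mem_nhds hp)

lemma Sm.diffAt (hu : Sm S u) (hp : p ∈ S) : DifferentiableAt ℝ u p :=
  (hu.contDiffAt hp).differentiableAt (by simp)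

lemma Sm.continuousAt (hu : Sm S u) (hp : p ∈ S) : ContinuousAt u p :=
  (hu.contDiffAt hp).continuousAt

lemma Sm.mono {T : Set Pt} (hu : Sm S u) (hT : IsOpen T) (h : T ⊆ S) : Sm T u :=
  ⟨hT, hu.contDiffOn.mono h⟩

lemma Sm.const (hS : IsOpen S) (c : ℂ) : Sm S fun _ => c := ⟨hS, contDiffOn_const⟩

lemma Sm.sub (hu : Sm S u) (hv : Sm S v) : Sm S fun q => u q - v q :=
  ⟨hu.isOpen, hu.contDiffOn.sub hv.contDiffOn⟩

lemma Sm.neg (hu : Sm S u) : Sm S fun q => -u q :=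
  ⟨hu.isOpen, hu.contDiffOn.neg⟩

lemma Sm.mul (hu : Sm S u) (hv : Sm S v) : Sm S fun q => u q * v q :=
  ⟨hu.isOpen, hu.contDiffOn.mul hv.contDiffOn⟩

lemma Sm.inv (hu : Sm S u) (h : ∀ q ∈ S, u q ≠ 0) : Sm S fun q => (u q)⁻¹ :=
  ⟨hu.isOpen, hu.contDiffOn.inv h⟩

lemma Sm.div (hu : Sm S u) (hv : Sm S v) (h : ∀ q ∈ S, v q ≠ 0) : Sm S fun q => u q / v q := by
  simpa only [div_eq_mul_inv] using hu.mul (hv.inv h)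

lemma Sm.sum {ι : Type*} {s : Finset ι} (hS : IsOpen S) {u : ι → Pt → ℂ}
    (h : ∀ i, Sm S (u i)) : Sm S fun q => ∑ i ∈ s, u i q :=
  ⟨hS, ContDiffOn.sum fun i _ => (h i).contDiffOn⟩

lemma Sm.star (hu : Sm S u) : Sm S fun q => star (u q) :=
  ⟨hu.isOpen, (conjCLE.contDiff (n := ∞)).comp_contDiffOn hu.contDiffOn⟩

lemma Sm.congr (hu : Sm S u) (h : ∀ q ∈ S, v q = u q) : Sm S v :=
  ⟨hu.isOpen, hu.contDiffOn.congr h⟩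

lemma Sm.coord (hS : IsOpen S) (i : Fin 2) : Sm S fun q => q.2 i := by
  refine ⟨hS, ContDiff.contDiffOn ?_⟩
  exact (contDiff_apply ℝ ℂ i).comp contDiff_snd

lemma Sm.wir (hu : Sm S u) (σ : ℂ) (w : Pt) : Sm S (wir σ w u) := by
  have h : ContDiffOn ℝ ∞ (fderiv ℝ u) S :=
    hu.contDiffOn.fderiv_of_isOpen hu.isOpen (by simp)
  refine ⟨hu.isOpen, ?_⟩
  unfold CFinsler.wir
  exact contDiffOn_const.mul ((h.clm_apply contDiffOn_const).sub
    (contDiffOn_const.mul (h.clm_apply contDiffOn_const)))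

lemma wir_congr (hS : IsOpen S) (h : ∀ q ∈ S, u q = v q) (hp : p ∈ S) :
    wir σ w u p = wir σ w v p := by
  have : u =ᶠ[nhds p] v := Filter.eventually_of_mem (hS.mem_nhds hp) h
  rw [wir, wir, this.fderiv_eq]

lemma wir_const (c : ℂ) : wir σ w (fun _ => c) p = 0 := by simp [wir]

lemma wir_sub (hu : Sm S u) (hv : Sm S v) (hp : p ∈ S) :
    wir σ w (fun q => u q - v q) p = wir σ w u p - wir σ w v p := by
  rw [wir, fderiv_fun_sub (hu.diffAt hp) (hv.diffAt hp)]
  simp [wir]; ring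

lemma wir_neg : wir σ w (fun q => -u q) p = -wir σ w u p := by
  rw [wir, fderiv_fun_neg]
  simp [wir]; ring

lemma wir_mul (hu : Sm S u) (hv : Sm S v) (hp : p ∈ S) :
    wir σ w (fun q => u q * v q) p = wir σ w u p * v p + u p * wir σ w v p := by
  rw [wir, fderiv_fun_mul (hu.diffAt hp) (hv.diffAt hp)]
  simp [wir]; ring

lemma wir_sum {ι : Type*} {s : Finset ι} {u : ι → Pt → ℂ} (h : ∀ i, Sm S (u i)) (hp : p ∈ S) :
    wir σ w (fun q => ∑ i ∈ s, u i q) p = ∑ i ∈ s, wir σ w (u i) p := by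
  rw [wir, fderiv_fun_sum fun i _ => (h i).diffAt hp]
  simp only [wir, sum_apply, Finset.mul_sum, ← Finset.sum_sub_distrib]

lemma wir_star (hu : Sm S u) (hp : p ∈ S) :
    wir σ w (fun q => star (u q)) p = star (wir (star σ) w u p) := by
  have : fderiv ℝ (fun q => star (u q)) p = (conjCLE : ℂ →L[ℝ] ℂ).comp (fderiv ℝ u p) :=
    ((conjCLE : ℂ →L[ℝ] ℂ).hasFDerivAt.comp p (hu.diffAt hp).hasFDerivAt).fderiv
  rw [wir, this, wir]
  simp

lemma wir_comm (hu : Sm S u) (hp : p ∈ S) :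
    wir σ w (wir τ w' u) p = wir τ w' (wir σ w u) p := by
  have h2 : ContDiffAt ℝ 2 u p := (hu.contDiffAt hp).of_le (by norm_cast)
  have hs : IsSymmSndFDerivAt ℝ u p := h2.isSymmSndFDerivAt (by simp)
  have hd : DifferentiableAt ℝ (fderiv ℝ u) p :=
    (h2.fderiv_right (m := 1) (by norm_num)).differentiableAt (by simp)
  have key : ∀ (τ : ℂ) (w' a : Pt), fderiv ℝ (wir τ w' u) p a =
      (1 / 2 : ℂ) * (fderiv ℝ (fderiv ℝ u) p a w' - τ * fderiv ℝ (fderiv ℝ u) p a (I • w')) := by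
    intro τ w' a
    have e : ∀ b : Pt, HasFDerivAt (fun q => fderiv ℝ u q b)
        ((ContinuousLinearMap.apply ℝ ℂ b).comp (fderiv ℝ (fderiv ℝ u) p)) p := fun b =>
      (ContinuousLinearMap.apply ℝ ℂ b).hasFDerivAt.comp p hd.hasFDerivAt
    have := (((e w').sub ((e (I • w')).const_mul τ)).const_mul (1 / 2 : ℂ)).fderiv
    unfold CFinsler.wir
    erw [this]
    simp
  rw [wir, key, key, wir, key, key]
  rw [hs w w', hs w (I • w'), hs (I • w) w', hs (I • w) (I • w')]
  ring

lemma wir_coord (i : Fin 2) :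
    wir σ w (fun q => q.2 i) p = (1 / 2 : ℂ) * (1 - σ * I) * w.2 i := by
  have : HasFDerivAt (fun q : Pt => q.2 i)
      ((ContinuousLinearMap.proj (R := ℝ) (φ := fun _ : Fin 2 => ℂ) i).comp
        (ContinuousLinearMap.snd ℝ C2 C2)) p :=
    ((ContinuousLinearMap.proj (R := ℝ) (φ := fun _ : Fin 2 => ℂ) i).comp
      (ContinuousLinearMap.snd ℝ C2 C2)).hasFDerivAt
  rw [wir, this.fderiv]
  simp; ring

/-- The horizontal and vertical Wirtinger derivatives determine the real differential. -/
lemma fderiv_eq_wir (u : Pt → ℂ) (p w : Pt) :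
    fderiv ℝ u p w = wir I w u p + wir (-I) w u p := by
  rw [wir, wir]; ring

/-- The factor is `c` for `σ = I` and its conjugate for `σ = -I`, so both types of derivative are
treated at once. -/
lemma wir_smul (hσ : σ ^ 2 = -1) (c : ℂ) :
    wir σ (c • w) u p = (c.re + c.im * σ) * wir σ w u p := by
  have h1 : c • w = c.re • w + c.im • (I • w) := by
    rw [← Complex.coe_smul, ← Complex.coe_smul, smul_smul, ← add_smul, re_add_im]
  have h2 : I • (c • w) = c.re • (I • w) - c.im • w := by
    rw [h1, smul_add, smul_comm I c.re, smul_comm I c.im, smul_smul I I, I_mul_I]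
    simp [sub_eq_add_neg]
  rw [wir, wir, h2, h1]
  simp only [map_add, map_sub, map_smul, real_smul]
  linear_combination (1 / 2 : ℂ) * c.im * fderiv ℝ u p (I • w) * hσ

lemma wir_dir_add : wir σ (w + w') u p = wir σ w u p + wir σ w' u p := by
  simp only [wir, smul_add, map_add]; ring

lemma vec_eq (a b : C2) : ((a, b) : Pt) =
    (a 0 • hdir 0 + a 1 • hdir 1) + (b 0 • vdir 0 + b 1 • vdir 1) := by
  ext i <;> fin_cases i <;> simp [hdir, vdir]

lemma wir_I_vec (a b : C2) (u : Pt → ℂ) (p : Pt) :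
    wir I (a, b) u p = ∑ k, a k * dz k u p + ∑ k, b k * dv k u p := by
  rw [vec_eq]
  simp only [wir_dir_add, wir_smul I_sq, re_add_im, dz_eq_wir, dv_eq_wir, Fin.sum_univ_two]

lemma wir_neg_I_vec (a b : C2) (u : Pt → ℂ) (p : Pt) :
    wir (-I) (a, b) u p = ∑ k, star (a k) * dzBar k u p + ∑ k, star (b k) * dvBar k u p := by
  have h : ∀ c : ℂ, (c.re : ℂ) + c.im * -I = star c := by
    intro c; apply Complex.ext <;> simp
  rw [vec_eq]
  simp only [wir_dir_add, wir_smul (σ := -I) (by simp), h, dzBar_eq_wir, dvBar_eq_wir,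
    Fin.sum_univ_two]

lemma dz_congr (hS : IsOpen S) (h : ∀ q ∈ S, u q = v q) (hp : p ∈ S) (k : Fin 2) :
    dz k u p = dz k v p := by
  rw [dz_eq_wir]; exact wir_congr hS h hp

lemma dz_mul (hu : Sm S u) (hv : Sm S v) (hp : p ∈ S) (k : Fin 2) :
    dz k (fun q => u q * v q) p = dz k u p * v p + u p * dz k v p := by
  rw [dz_eq_wir]; exact wir_mul hu hv hp

lemma dz_sum {ι : Type*} {s : Finset ι} {u : ι → Pt → ℂ} (h : ∀ i, Sm S (u i)) (hp : p ∈ S)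
    (k : Fin 2) : dz k (fun q => ∑ i ∈ s, u i q) p = ∑ i ∈ s, dz k (u i) p := by
  rw [dz_eq_wir]; exact wir_sum h hp

lemma dz_star (hu : Sm S u) (hp : p ∈ S) (k : Fin 2) :
    dz k (fun q => star (u q)) p = star (dzBar k u p) := by
  rw [dz_eq_wir, dzBar_eq_wir, wir_star hu hp]; simp

lemma Sm.dz (hu : Sm S u) (k : Fin 2) : Sm S (dz k u) := by
  rw [dz_eq_wir]; exact hu.wir _ _

lemma dzBar_congr (hS : IsOpen S) (h : ∀ q ∈ S, u q = v q) (hp : p ∈ S) (k : Fin 2) :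
    dzBar k u p = dzBar k v p := by
  rw [dzBar_eq_wir]; exact wir_congr hS h hp

lemma dzBar_mul (hu : Sm S u) (hv : Sm S v) (hp : p ∈ S) (k : Fin 2) :
    dzBar k (fun q => u q * v q) p = dzBar k u p * v p + u p * dzBar k v p := by
  rw [dzBar_eq_wir]; exact wir_mul hu hv hp

lemma dzBar_sum {ι : Type*} {s : Finset ι} {u : ι → Pt → ℂ} (h : ∀ i, Sm S (u i)) (hp : p ∈ S)
    (k : Fin 2) : dzBar k (fun q => ∑ i ∈ s, u i q) p = ∑ i ∈ s, dzBar k (u i) p := by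
  rw [dzBar_eq_wir]; exact wir_sum h hp

lemma dzBar_star (hu : Sm S u) (hp : p ∈ S) (k : Fin 2) :
    dzBar k (fun q => star (u q)) p = star (dz k u p) := by
  rw [dzBar_eq_wir, dz_eq_wir, wir_star hu hp]; simp

lemma Sm.dzBar (hu : Sm S u) (k : Fin 2) : Sm S (dzBar k u) := by
  rw [dzBar_eq_wir]; exact hu.wir _ _

lemma dv_congr (hS : IsOpen S) (h : ∀ q ∈ S, u q = v q) (hp : p ∈ S) (k : Fin 2) :
    dv k u p = dv k v p := by
  rw [dv_eq_wir]; exact wir_congr hS h hp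

lemma dv_mul (hu : Sm S u) (hv : Sm S v) (hp : p ∈ S) (k : Fin 2) :
    dv k (fun q => u q * v q) p = dv k u p * v p + u p * dv k v p := by
  rw [dv_eq_wir]; exact wir_mul hu hv hp

lemma dv_sum {ι : Type*} {s : Finset ι} {u : ι → Pt → ℂ} (h : ∀ i, Sm S (u i)) (hp : p ∈ S)
    (k : Fin 2) : dv k (fun q => ∑ i ∈ s, u i q) p = ∑ i ∈ s, dv k (u i) p := by
  rw [dv_eq_wir]; exact wir_sum h hp

lemma dv_star (hu : Sm S u) (hp : p ∈ S) (k : Fin 2) :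
    dv k (fun q => star (u q)) p = star (dvBar k u p) := by
  rw [dv_eq_wir, dvBar_eq_wir, wir_star hu hp]; simp

lemma Sm.dv (hu : Sm S u) (k : Fin 2) : Sm S (dv k u) := by
  rw [dv_eq_wir]; exact hu.wir _ _

lemma dvBar_congr (hS : IsOpen S) (h : ∀ q ∈ S, u q = v q) (hp : p ∈ S) (k : Fin 2) :
    dvBar k u p = dvBar k v p := by
  rw [dvBar_eq_wir]; exact wir_congr hS h hp

lemma dvBar_mul (hu : Sm S u) (hv : Sm S v) (hp : p ∈ S) (k : Fin 2) :
    dvBar k (fun q => u q * v q) p = dvBar k u p * v p + u p * dvBar k v p := by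
  rw [dvBar_eq_wir]; exact wir_mul hu hv hp

lemma dvBar_sum {ι : Type*} {s : Finset ι} {u : ι → Pt → ℂ} (h : ∀ i, Sm S (u i)) (hp : p ∈ S)
    (k : Fin 2) : dvBar k (fun q => ∑ i ∈ s, u i q) p = ∑ i ∈ s, dvBar k (u i) p := by
  rw [dvBar_eq_wir]; exact wir_sum h hp

lemma dvBar_star (hu : Sm S u) (hp : p ∈ S) (k : Fin 2) :
    dvBar k (fun q => star (u q)) p = star (dv k u p) := by
  rw [dvBar_eq_wir, dv_eq_wir, wir_star hu hp]; simp

lemma Sm.dvBar (hu : Sm S u) (k : Fin 2) : Sm S (dvBar k u) := by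
  rw [dvBar_eq_wir]; exact hu.wir _ _

end Calculus

section LocalMetric

/-! ### Complex Finsler metrics on an open subset of `ℂ²` -/

/-- The nonzero tangent vectors over `Ω`. -/
def sl (Ω : Set C2) : Set Pt := {p | p.1 ∈ Ω ∧ p.2 ≠ 0}

lemma isOpen_sl {Ω : Set C2} (h : IsOpen Ω) : IsOpen (sl Ω) :=
  (h.preimage continuous_fst).inter (isOpen_ne.preimage continuous_snd)

/-- The function `L = F²`. -/
def energy (f : Pt → ℝ) (p : Pt) : ℂ := ((f p ^ 2 : ℝ) : ℂ)

/-- A complex Finsler metric on an open set of `ℂ²`. -/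
structure LocalFinsler (f : Pt → ℝ) (Ω : Set C2) : Prop where
  isOpen : IsOpen Ω
  smooth : ContDiffOn ℝ ∞ (fun p => f p ^ 2) (sl Ω)
  nonneg : ∀ p, 0 ≤ f p
  hom : ∀ z ∈ Ω, ∀ (c : ℂ) (η : C2), f (z, c • η) = ‖c‖ * f (z, η)
  posDef : ∀ p ∈ sl Ω, (gMat f p).PosDef

variable {f : Pt → ℝ} {Ω : Set C2} {p : Pt}

lemma g_def (i j : Fin 2) : g f i j = dv i (dvBar j (energy f)) := rfl

lemma star_energy (p : Pt) : star (energy f p) = energy f p := by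
  simp [energy]

namespace LocalFinsler

variable (h : LocalFinsler f Ω)
include h

lemma open_sl : IsOpen (sl Ω) := isOpen_sl h.isOpen

lemma sm_energy : Sm (sl Ω) (energy f) :=
  ⟨h.open_sl, (ofRealCLM.contDiff (n := ∞)).comp_contDiffOn h.smooth⟩

lemma sm_g (i j : Fin 2) : Sm (sl Ω) (g f i j) := by
  exact (h.sm_energy.dvBar j).dv i

lemma sm_L (k : Fin 2) : Sm (sl Ω) (dv k (energy f)) := h.sm_energy.dv k

lemma sm_coord (i : Fin 2) : Sm (sl Ω) fun q => q.2 i := Sm.coord h.open_sl i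

lemma sm_coord_star (i : Fin 2) : Sm (sl Ω) fun q => star (q.2 i) := (h.sm_coord i).star

/-- Differentiate `L(z, (1 + tc)η) = |1 + tc|² L(z, η)` at `t = 0`. The cases `c = 1` and `c = I`
together give Euler's identity. -/
lemma fderiv_radial (hp : p ∈ sl Ω) (c : ℂ) :
    fderiv ℝ (energy f) p (0, c • p.2) = 2 * c.re * energy f p := by
  have hc : HasDerivAt (fun t : ℝ => ((p.1, p.2 + t • (c • p.2)) : Pt)) (0, c • p.2) 0 := by
    refine (hasDerivAt_const _ _).prodMk ?_
    simpa using ((hasDerivAt_id (0 : ℝ)).smul_const (c • p.2)).const_add p.2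
  have h0 : ((p.1, p.2 + (0 : ℝ) • (c • p.2)) : Pt) = p := by simp
  have h1 := (h0.symm ▸ (h.sm_energy.diffAt hp).hasFDerivAt :
    HasFDerivAt (energy f) (fderiv ℝ (energy f) p)
      ((p.1, p.2 + (0 : ℝ) • (c • p.2)) : Pt)).comp_hasDerivAt (0 : ℝ) hc
  have h2 : (energy f ∘ fun t : ℝ => ((p.1, p.2 + t • (c • p.2)) : Pt)) =
      fun t : ℝ => (((1 + t * c.re) ^ 2 + (t * c.im) ^ 2 : ℝ) : ℂ) * energy f p := by
    funext t
    have e : p.2 + t • (c • p.2) = (1 + t * c : ℂ) • p.2 := by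
      rw [add_smul, one_smul, mul_smul, Complex.coe_smul]
    have e2 : ‖(1 + t * c : ℂ)‖ ^ 2 = (1 + t * c.re) ^ 2 + (t * c.im) ^ 2 := by
      rw [Complex.sq_norm, Complex.normSq_apply]; simp; ring
    rw [Function.comp_apply, energy, energy, e, h.hom p.1 hp.1, mul_pow, e2, ofReal_mul]
  have h3 : HasDerivAt (fun t : ℝ => (((1 + t * c.re) ^ 2 + (t * c.im) ^ 2 : ℝ) : ℂ) * energy f p)
      (((2 * c.re : ℝ) : ℂ) * energy f p) 0 := by
    refine HasDerivAt.mul_const (HasDerivAt.ofReal_comp ?_) _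
    have a := (((hasDerivAt_id (0 : ℝ)).mul_const c.re).const_add 1).pow 2
    have b := ((hasDerivAt_id (0 : ℝ)).mul_const c.im).pow 2
    exact (a.add b).congr_deriv (by simp)
  rw [h2] at h1
  rw [h1.unique h3]; push_cast; ring

lemma euler (hp : p ∈ sl Ω) : ∑ k, p.2 k * dv k (energy f) p = energy f p := by
  have a := wir_I_vec 0 p.2 (energy f) p
  have b := h.fderiv_radial hp 1
  have c := h.fderiv_radial hp I
  rw [wir, Prod.smul_mk, smul_zero, c] at a
  rw [one_smul] at b
  rw [b] at a
  simp at a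
  simpa using a.symm

lemma dvBar_energy (k : Fin 2) (hp : p ∈ sl Ω) :
    dvBar k (energy f) p = star (dv k (energy f) p) := by
  simpa only [star_energy] using dvBar_star h.sm_energy hp k

lemma dzBar_energy (k : Fin 2) (hp : p ∈ sl Ω) :
    dzBar k (energy f) p = star (dz k (energy f) p) := by
  simpa only [star_energy] using dzBar_star h.sm_energy hp k

lemma g_eq (i j : Fin 2) (hp : p ∈ sl Ω) : g f i j p = dvBar j (dv i (energy f)) p := by
  rw [g_def, dv_eq_wir, dvBar_eq_wir]; exact wir_comm h.sm_energy hp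

lemma star_g (i j : Fin 2) (hp : p ∈ sl Ω) : star (g f i j p) = g f j i p := by
  rw [h.g_eq i j hp, g_def]
  rw [dv_congr h.open_sl (fun q hq => h.dvBar_energy i hq) hp, dv_star (h.sm_L i) hp]

lemma L_symm (k l : Fin 2) (hp : p ∈ sl Ω) :
    dv k (dv l (energy f)) p = dv l (dv k (energy f)) p := by
  simp only [dv_eq_wir]; exact wir_comm h.sm_energy hp

end LocalFinsler

lemma dv_coord (i k : Fin 2) : dv k (fun q => q.2 i) p = if i = k then 1 else 0 := by
  rw [dv_eq_wir, wir_coord]; simp [vdir, Pi.single_apply]; norm_num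

lemma dvBar_coord (i k : Fin 2) : dvBar k (fun q => q.2 i) p = 0 := by
  rw [dvBar_eq_wir, wir_coord]; simp

lemma dz_coord (i k : Fin 2) : dz k (fun q => q.2 i) p = 0 := by
  rw [dz_eq_wir, wir_coord]; simp [hdir]

lemma dzBar_coord (i k : Fin 2) : dzBar k (fun q => q.2 i) p = 0 := by
  rw [dzBar_eq_wir, wir_coord]; simp [hdir]

lemma wir_coord_star {σ : ℂ} {w : Pt} (i : Fin 2) :
    wir σ w (fun q => star (q.2 i)) p = star (wir (star σ) w (fun q => q.2 i) p) :=
  wir_star (Sm.coord isOpen_univ i) (Set.mem_univ p)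

lemma dv_coord_star (i k : Fin 2) : dv k (fun q => star (q.2 i)) p = 0 := by
  rw [dv_eq_wir, wir_coord_star, wir_coord]; simp

lemma dvBar_coord_star (i k : Fin 2) :
    dvBar k (fun q => star (q.2 i)) p = if i = k then 1 else 0 := by
  have := dv_coord (p := p) i k
  rw [dv_eq_wir] at this
  rw [dvBar_eq_wir, wir_coord_star]
  simp only [star_neg, star_def, conj_I, neg_neg, this]
  split_ifs <;> simp

lemma dz_coord_star (i k : Fin 2) : dz k (fun q => star (q.2 i)) p = 0 := by
  rw [dz_eq_wir, wir_coord_star, wir_coord]; simp [hdir]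

end LocalMetric

/-! ### Euler identities and the Chern-Finsler coefficients -/

namespace LocalFinsler

variable {f : Pt → ℝ} {Ω : Set C2} {p : Pt} (h : LocalFinsler f Ω)
include h

lemma eulerBar (hp : p ∈ sl Ω) : ∑ k, star (p.2 k) * dvBar k (energy f) p = energy f p := by
  have := congrArg star (h.euler hp)
  simpa [h.dvBar_energy _ hp, star_energy, -star_def] using this

lemma sum_g_star (i : Fin 2) (hp : p ∈ sl Ω) :
    ∑ j, g f i j p * star (p.2 j) = dv i (energy f) p := by
  rw [← dv_congr h.open_sl (fun q hq => h.eulerBar hq) hp,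
    dv_sum (fun k => (h.sm_coord_star k).mul (h.sm_energy.dvBar k)) hp]
  refine Finset.sum_congr rfl fun j _ => ?_
  rw [dv_mul (h.sm_coord_star j) (h.sm_energy.dvBar j) hp, dv_coord_star, g_def]; ring

lemma sum_L2 (k : Fin 2) (hp : p ∈ sl Ω) :
    ∑ l, p.2 l * dv k (dv l (energy f)) p = 0 := by
  have := dv_congr h.open_sl (fun q hq => h.euler hq) hp k
  rw [dv_sum (fun k => (h.sm_coord k).mul (h.sm_L k)) hp] at this
  simp only [dv_mul (h.sm_coord _) (h.sm_L _) hp, dv_coord, Finset.sum_add_distrib] at this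
  simpa using this

lemma sum_dvg_star (l j : Fin 2) (hp : p ∈ sl Ω) :
    ∑ r, dv l (g f j r) p * star (p.2 r) = dv l (dv j (energy f)) p := by
  rw [← dv_congr h.open_sl (fun q hq => h.sum_g_star j hq) hp,
    dv_sum (fun k => (h.sm_g j k).mul (h.sm_coord_star k)) hp]
  refine Finset.sum_congr rfl fun r _ => ?_
  rw [dv_mul (h.sm_g j r) (h.sm_coord_star r) hp, dv_coord_star]; ring

lemma sum_g (l : Fin 2) (hp : p ∈ sl Ω) :
    ∑ j, p.2 j * g f j l p = dvBar l (energy f) p := by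
  rw [h.dvBar_energy l hp, ← h.sum_g_star l hp, star_sum]
  refine Finset.sum_congr rfl fun r _ => ?_
  rw [star_mul', star_star, h.star_g l r hp]; ring

/-- Differentiating `η^j g_{j l̄} = ∂L/∂η̄^l` in `η^m` produces `g_{m l̄}` on both sides, which
cancels. -/
lemma sum_dvg (m l : Fin 2) (hp : p ∈ sl Ω) :
    ∑ j, p.2 j * dv m (g f j l) p = 0 := by
  have := dv_congr h.open_sl (fun q hq => h.sum_g l hq) hp m
  rw [dv_sum (fun k => (h.sm_coord k).mul (h.sm_g k l)) hp, ← g_def] at this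
  simp only [dv_mul (h.sm_coord _) (h.sm_g _ _) hp, dv_coord, Finset.sum_add_distrib] at this
  simpa using this

lemma det_pos (hp : p ∈ sl Ω) : 0 < (gMat f p).det := (h.posDef p hp).det_pos

lemma det_ne (hp : p ∈ sl Ω) : (gMat f p).det ≠ 0 := (h.det_pos hp).ne'

lemma gInv_mul_g (l k : Fin 2) (hp : p ∈ sl Ω) :
    ∑ m, gInv f l m p * g f m k p = if l = k then 1 else 0 := by
  have := congrFun (congrFun (Matrix.nonsing_inv_mul (gMat f p) (h.det_ne hp).isUnit) l) k
  rwa [Matrix.mul_apply, Matrix.one_apply] at this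

-- Stated for an arbitrary `u` because `N`, `Lc` and `Cc` are all defined by raising an index;
-- lowering it again removes the inverse matrix from later computations.
omit h in
lemma contract_gInv (u : Fin 2 → ℂ) (n : Fin 2)
    (hg : ∀ l k, ∑ m, gInv f l m p * g f m k p = if l = k then 1 else 0) :
    ∑ k, (∑ m, gInv f m k p * u m) * g f k n p = u n := by
  simp only [Finset.sum_mul]
  rw [Finset.sum_comm]
  have : ∀ m, ∑ k, gInv f m k p * u m * g f k n p = u m * if m = n then 1 else 0 := by
    intro m
    rw [← hg m n, Finset.mul_sum]
    exact Finset.sum_congr rfl fun _ _ => by ring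
  simp [this]

lemma N_g (j n : Fin 2) (hp : p ∈ sl Ω) :
    ∑ k, N f k j p * g f k n p = ∑ l, dz j (g f l n) p * p.2 l := by
  rw [← contract_gInv (fun m => ∑ l, dz j (g f l m) p * p.2 l) n fun l k => h.gInv_mul_g l k hp]
  simp only [N, Finset.mul_sum, mul_assoc]

lemma Lc_g (j k n : Fin 2) (hp : p ∈ sl Ω) :
    ∑ i, Lc f i j k p * g f i n p = delta f k (g f j n) p := by
  rw [← contract_gInv (fun m => delta f k (g f j m) p) n fun l k => h.gInv_mul_g l k hp]
  simp only [Lc]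

lemma Cc_g (j k n : Fin 2) (hp : p ∈ sl Ω) :
    ∑ i, Cc f i j k p * g f i n p = dv k (g f j n) p := by
  rw [← contract_gInv (fun m => dv k (g f j m) p) n fun l k => h.gInv_mul_g l k hp]
  simp only [Cc]

lemma sum_g_star_star (hp : p ∈ sl Ω) :
    ∑ n, ∑ l, g f l n p * p.2 l * star (p.2 n) = energy f p := by
  rw [← h.eulerBar hp]
  refine Finset.sum_congr rfl fun n _ => ?_
  rw [← h.sum_g n hp, Finset.mul_sum]
  exact Finset.sum_congr rfl fun _ _ => by ring

/-- The fundamental function is horizontally constant. -/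
lemma dz_energy (j : Fin 2) (hp : p ∈ sl Ω) :
    dz j (energy f) p = ∑ k, N f k j p * dv k (energy f) p := by
  have h1 := fun n => h.N_g j n hp
  have h2 := fun n => h.sum_g_star n hp
  rw [← dz_congr h.open_sl (fun q hq => h.sum_g_star_star hq) hp]
  rw [dz_sum (fun n => Sm.sum h.open_sl fun l =>
    ((h.sm_g l n).mul (h.sm_coord l)).mul (h.sm_coord_star n)) hp]
  simp only [dz_sum (fun l => ((h.sm_g l _).mul (h.sm_coord l)).mul (h.sm_coord_star _)) hp,
    dz_mul ((h.sm_g _ _).mul (h.sm_coord _)) (h.sm_coord_star _) hp,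
    dz_mul (h.sm_g _ _) (h.sm_coord _) hp, dz_coord, dz_coord_star, ← h2]
  simp only [mul_zero, add_zero, Fin.sum_univ_two] at h1 ⊢
  linear_combination (-star (p.2 0)) * h1 0 - star (p.2 1) * h1 1

/-- The vertical part of `δ_k` drops out under contraction with η, by `sum_dvg`. -/
lemma Lc_eta (i k : Fin 2) (hp : p ∈ sl Ω) :
    ∑ j, Lc f i j k p * p.2 j = N f i k p := by
  have h1 : ∀ l, ∑ j, p.2 j * delta f k (g f j l) p = ∑ j, dz k (g f j l) p * p.2 j := by
    intro l
    have := fun m => h.sum_dvg m l hp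
    simp only [delta, Fin.sum_univ_two] at this ⊢
    linear_combination (-N f 0 k p) * this 0 - N f 1 k p * this 1
  simp only [Lc, N, Finset.sum_mul]
  rw [Finset.sum_comm]
  refine Finset.sum_congr rfl fun l _ => ?_
  have := congrArg (gInv f l i p * ·) (h1 l)
  simp only [Finset.mul_sum] at this
  rw [Finset.sum_congr rfl fun j _ => show gInv f l i p * delta f k (g f j l) p * p.2 j =
    gInv f l i p * (p.2 j * delta f k (g f j l) p) by ring, this]
  exact Finset.sum_congr rfl fun _ _ => by ring

lemma sm_det : Sm (sl Ω) fun q => (gMat f q).det := by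
  simp only [Matrix.det_fin_two, gMat, Matrix.of_apply]
  exact ((h.sm_g 0 0).mul (h.sm_g 1 1)).sub ((h.sm_g 0 1).mul (h.sm_g 1 0))

lemma sm_gInv (m k : Fin 2) : Sm (sl Ω) (gInv f m k) := by
  have e : ∀ q, gInv f m k q = (gMat f q).det⁻¹ * (gMat f q).adjugate m k := by
    intro q; rw [gInv, Matrix.inv_def]; simp
  refine Sm.congr (Sm.mul (h.sm_det.inv fun q hq => h.det_ne hq) ?_) fun q _ => e q
  simp only [Matrix.adjugate_fin_two, gMat, Matrix.of_apply]
  fin_cases m <;> fin_cases k <;> simp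
  exacts [h.sm_g 1 1, (h.sm_g 0 1).neg, (h.sm_g 1 0).neg, h.sm_g 0 0]

lemma sm_N (k j : Fin 2) : Sm (sl Ω) (N f k j) :=
  Sm.sum h.open_sl fun m => Sm.sum h.open_sl fun l =>
    ((h.sm_gInv m k).mul ((h.sm_g l m).dz j)).mul (h.sm_coord l)

lemma sm_delta {u : Pt → ℂ} (hu : Sm (sl Ω) u) (k : Fin 2) : Sm (sl Ω) (delta f k u) :=
  (hu.dz k).sub (Sm.sum h.open_sl fun j => (h.sm_N j k).mul (hu.dv j))

lemma sm_Lc (i j k : Fin 2) : Sm (sl Ω) (Lc f i j k) :=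
  Sm.sum h.open_sl fun l => (h.sm_gInv l i).mul (h.sm_delta (h.sm_g j l) k)

end LocalFinsler

/-! ### Berwald metrics -/

/-- A complex Berwald metric on an open set of `ℂ²`. -/
structure LocalBerwald (f : Pt → ℝ) (Ω : Set C2) : Prop extends LocalFinsler f Ω where
  kahler : ∀ p ∈ sl Ω, ∀ i k : Fin 2, ∑ j, (Lc f i j k p - Lc f i k j p) * p.2 j = 0
  indep : ∀ p ∈ sl Ω, ∀ q ∈ sl Ω, p.1 = q.1 → ∀ i j k : Fin 2, Lc f i j k p = Lc f i j k q

/-- `u` does not depend on the fibre coordinate. -/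
def VertConst (Ω : Set C2) (u : Pt → ℂ) : Prop :=
  ∀ p ∈ sl Ω, ∀ q ∈ sl Ω, p.1 = q.1 → u p = u q

/-! ### Functions constant along the fibres. -/

section VertConst

variable {Ω : Set C2} {u : Pt → ℂ} {p q : Pt}

/-- Near `p` the function factors through `r ↦ (r.1, q.2)`. Comparing two points of a fibre, not
just one, is what lets `∂/∂z̄` preserve fibrewise constancy. -/
lemma VertConst.fderiv (hv : VertConst Ω u) (hu : Sm (sl Ω) u) (hp : p ∈ sl Ω) (hq : q ∈ sl Ω)
    (hpq : p.1 = q.1) (w : Pt) : fderiv ℝ u p w = fderiv ℝ u q (w.1, 0) := by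
  have e : u =ᶠ[nhds p] u ∘ fun r : Pt => (r.1, q.2) := by
    filter_upwards [hu.isOpen.mem_nhds hp] with r hr
    exact hv r hr (r.1, q.2) ⟨hr.1, hq.2⟩ rfl
  have hφ : HasFDerivAt (fun r : Pt => ((r.1, q.2) : Pt))
      ((ContinuousLinearMap.fst ℝ C2 C2).prod 0) p :=
    (ContinuousLinearMap.fst ℝ C2 C2).hasFDerivAt.prodMk (hasFDerivAt_const _ _)
  have hq' : ((p.1, q.2) : Pt) = q := Prod.ext hpq rfl
  have h1 : HasFDerivAt u (_root_.fderiv ℝ u q) ((fun r : Pt => ((r.1, q.2) : Pt)) p) := by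
    rw [show (fun r : Pt => ((r.1, q.2) : Pt)) p = q from hq']
    exact (hu.diffAt hq).hasFDerivAt
  rw [e.fderiv_eq, (h1.comp p hφ).fderiv]
  rfl

variable (hv : VertConst Ω u) (hu : Sm (sl Ω) u) (hp : p ∈ sl Ω)
include hv hu hp

lemma VertConst.dv (k : Fin 2) : dv k u p = 0 := by
  rw [CFinsler.dv, hv.fderiv hu hp hp rfl, hv.fderiv hu hp hp rfl (0, Pi.single k I)]
  simp [← Prod.zero_eq_mk]

lemma VertConst.dvBar (k : Fin 2) : dvBar k u p = 0 := by
  rw [CFinsler.dvBar, hv.fderiv hu hp hp rfl, hv.fderiv hu hp hp rfl (0, Pi.single k I)]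
  simp [← Prod.zero_eq_mk]

omit hp in
lemma VertConst.dzBar (k : Fin 2) : VertConst Ω (dzBar k u) := by
  intro p hp q hq hpq
  simp only [CFinsler.dzBar, hv.fderiv hu hp hq hpq]

end VertConst

/-- The curvature coefficients `-∂L^l_{mk}/∂z̄^h` of a Berwald metric. -/
def Pc (f : Pt → ℝ) (l m h k : Fin 2) (p : Pt) : ℂ := -dzBar h (Lc f l m k) p

/-- The contraction `Pc^l_{m h̄ k} η^m ∂L/∂η^l`. -/
def Yc (f : Pt → ℝ) (h k : Fin 2) (p : Pt) : ℂ :=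
  ∑ l, (∑ m, Pc f l m h k p * p.2 m) * dv l (energy f) p

namespace LocalBerwald

variable {f : Pt → ℝ} {Ω : Set C2} {p : Pt} (h : LocalBerwald f Ω)
include h

lemma vertConst_Lc (i j k : Fin 2) : VertConst Ω (Lc f i j k) :=
  fun p hp q hq hpq => h.indep p hp q hq hpq i j k

lemma Lc_symm (i j k : Fin 2) (hp : p ∈ sl Ω) : Lc f i j k p = Lc f i k j p := by
  -- Since the coefficients do not depend on η, the Kähler identity may be evaluated at the basis
  -- vector `e_j`, which isolates one component of the torsion.
  have hq : ((p.1, Pi.single j 1) : Pt) ∈ sl Ω := ⟨hp.1, by simp⟩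
  have := h.kahler _ hq i k
  rw [h.indep p hp _ hq rfl, h.indep p hp _ hq rfl i k j]
  simpa [Pi.single_apply, sub_eq_zero] using this

lemma dvBar_Lc (i j k l : Fin 2) (hp : p ∈ sl Ω) : dvBar l (Lc f i j k) p = 0 :=
  (h.vertConst_Lc i j k).dvBar (h.sm_Lc i j k) hp l

lemma sm_Pc (l m s k : Fin 2) : Sm (sl Ω) (Pc f l m s k) := ((h.sm_Lc l m k).dzBar s).neg

lemma vertConst_Pc (l m s k : Fin 2) : VertConst Ω (Pc f l m s k) := by
  intro p hp q hq hpq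
  rw [Pc, Pc, (h.vertConst_Lc l m k).dzBar (h.sm_Lc l m k) s p hp q hq hpq]

lemma Pc_symm (l m s k : Fin 2) (hp : p ∈ sl Ω) : Pc f l m s k p = Pc f l k s m p := by
  rw [Pc, Pc, dzBar_congr h.open_sl (fun q hq => h.Lc_symm l m k hq) hp]

lemma dzBar_N (l k s : Fin 2) (hp : p ∈ sl Ω) :
    dzBar s (N f l k) p = -∑ m, Pc f l m s k p * p.2 m := by
  rw [← dzBar_congr h.open_sl (fun q hq => h.Lc_eta l k hq) hp,
    dzBar_sum (fun m => (h.sm_Lc l m k).mul (h.sm_coord m)) hp, ← Finset.sum_neg_distrib]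
  refine Finset.sum_congr rfl fun m _ => ?_
  rw [dzBar_mul (h.sm_Lc l m k) (h.sm_coord m) hp, dzBar_coord, Pc]; ring

lemma dvBar_N (l k s : Fin 2) (hp : p ∈ sl Ω) : dvBar s (N f l k) p = 0 := by
  rw [← dvBar_congr h.open_sl (fun q hq => h.Lc_eta l k hq) hp,
    dvBar_sum (fun m => (h.sm_Lc l m k).mul (h.sm_coord m)) hp]
  refine Finset.sum_eq_zero fun m _ => ?_
  rw [dvBar_mul (h.sm_Lc l m k) (h.sm_coord m) hp, dvBar_coord, h.dvBar_Lc _ _ _ _ hp]; ring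

lemma deltaBar_Lc (i j k s : Fin 2) (hp : p ∈ sl Ω) :
    deltaBar f s (Lc f i j k) p = -Pc f i j s k p := by
  simp [deltaBar, Pc, h.dvBar_Lc _ _ _ _ hp]

lemma deltaBar_N (l k s : Fin 2) (hp : p ∈ sl Ω) :
    deltaBar f s (N f l k) p = -∑ m, Pc f l m s k p * p.2 m := by
  simp [deltaBar, h.dvBar_N _ _ _ hp, h.dzBar_N _ _ _ hp]

lemma R_eq (r j s k : Fin 2) (hp : p ∈ sl Ω) :
    R f r j s k p = ∑ l, g f l r p * Pc f l j s k p +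
      ∑ l, (∑ m, Pc f l m s k p * p.2 m) * dv l (g f j r) p := by
  have h1 := fun l => h.Cc_g j l r hp
  simp only [R, Rup, h.deltaBar_N _ _ _ hp, h.deltaBar_Lc _ _ _ _ hp, Fin.sum_univ_two] at h1 ⊢
  linear_combination (Pc f 0 0 s k p * p.2 0 + Pc f 0 1 s k p * p.2 1) * h1 0 +
    (Pc f 1 0 s k p * p.2 0 + Pc f 1 1 s k p * p.2 1) * h1 1

/-- Apply `∂/∂η^l` to the conjugate of `dz_energy`. The conjugate of `N` passes through because `N`
is holomorphic in η. -/
lemma dzBar_L (l s : Fin 2) (hp : p ∈ sl Ω) :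
    dzBar s (dv l (energy f)) p = ∑ b, star (N f b s p) * g f l b p := by
  have e : ∀ q ∈ sl Ω, dzBar s (energy f) q = ∑ b, star (N f b s q) * dvBar b (energy f) q := by
    intro q hq
    rw [h.dzBar_energy s hq, h.dz_energy s hq, star_sum]
    exact Finset.sum_congr rfl fun b _ => by rw [star_mul', h.dvBar_energy b hq]
  have c : dzBar s (dv l (energy f)) p = dv l (dzBar s (energy f)) p := by
    rw [dzBar_eq_wir, dv_eq_wir]; exact wir_comm h.sm_energy hp
  rw [c, dv_congr h.open_sl e hp,
    dv_sum (fun b => (h.sm_N b s).star.mul (h.sm_energy.dvBar b)) hp]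
  refine Finset.sum_congr rfl fun b _ => ?_
  rw [dv_mul (h.sm_N b s).star (h.sm_energy.dvBar b) hp, dv_star (h.sm_N b s) hp,
    h.dvBar_N _ _ _ hp, g_def]
  simp

lemma dzBar_dz_energy (s k : Fin 2) (hp : p ∈ sl Ω) :
    dzBar s (dz k (energy f)) p =
      -Yc f s k p + ∑ l, ∑ b, N f l k p * star (N f b s p) * g f l b p := by
  rw [dzBar_congr h.open_sl (fun q hq => h.dz_energy k hq) hp,
    dzBar_sum (fun l => (h.sm_N l k).mul (h.sm_L l)) hp, Yc, ← Finset.sum_neg_distrib,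
    ← Finset.sum_add_distrib]
  refine Finset.sum_congr rfl fun l _ => ?_
  rw [dzBar_mul (h.sm_N l k) (h.sm_L l) hp, h.dzBar_N _ _ _ hp, h.dzBar_L _ _ hp, Finset.mul_sum]
  simp only [mul_assoc, neg_mul]

/-- The mixed derivatives of the real function `L` commute, and the term quadratic in `N` in
`dzBar_dz_energy` is already Hermitian; the curvature term must then be Hermitian too. -/
lemma Yc_herm (s k : Fin 2) (hp : p ∈ sl Ω) : Yc f s k p = star (Yc f k s p) := by
  have c : dzBar s (dz k (energy f)) p = dz k (dzBar s (energy f)) p := by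
    rw [dzBar_eq_wir, dz_eq_wir]; exact wir_comm h.sm_energy hp
  rw [dz_congr h.open_sl (fun q hq => h.dzBar_energy s hq) hp, dz_star (h.sm_energy.dz s) hp,
    h.dzBar_dz_energy s k hp, h.dzBar_dz_energy k s hp] at c
  have e : star (∑ l, ∑ b, N f l s p * star (N f b k p) * g f l b p) =
      ∑ l, ∑ b, N f l k p * star (N f b s p) * g f l b p := by
    simp only [star_sum, star_mul', star_star, h.star_g _ _ hp]
    rw [Finset.sum_comm]
    exact Finset.sum_congr rfl fun _ _ => Finset.sum_congr rfl fun _ _ => by ring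
  rw [star_add, e, star_neg] at c
  linear_combination -c

end LocalBerwald

/-! ### Vanishing of the curvature at a point with a non-quadratic norm -/

/-- A homogeneous cubic in two variables vanishing on a nonempty open set is zero. -/
lemma cubic_eq_zero {O : Set C2} (hO : IsOpen O) {e : C2} (he : e ∈ O) {a b c d : ℂ}
    (h : ∀ η ∈ O, a * η 0 ^ 3 + b * (η 0 ^ 2 * η 1) + c * (η 0 * η 1 ^ 2) + d * η 1 ^ 3 = 0) :
    a = 0 ∧ b = 0 ∧ c = 0 ∧ d = 0 := by
  -- With the first coordinate frozen at a nonzero `x`, the cubic becomes a one-variable polynomial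
  -- with infinitely many roots, and powers of `x` can be cancelled from its coefficients.
  obtain ⟨x, hx, hxO⟩ : ∃ x : ℂ, x ≠ 0 ∧ ![x, e 1] ∈ O := by
    have hc : Continuous fun x : ℂ => ![x, e 1] := by fun_prop
    have h1 : ∀ᶠ x in nhdsWithin (e 0) {e 0}ᶜ, ![x, e 1] ∈ O := by
      refine Filter.Eventually.filter_mono nhdsWithin_le_nhds (hc.continuousAt.eventually_mem ?_)
      refine hO.mem_nhds ?_
      convert he using 1
      ext i; fin_cases i <;> rfl
    by_cases h0 : e 0 = 0
    · obtain ⟨x, hx, hx'⟩ := (h1.and self_mem_nhdsWithin).exists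
      exact ⟨x, by simpa [h0] using hx', hx⟩
    · refine ⟨e 0, h0, ?_⟩
      convert he using 1
      ext i; fin_cases i <;> rfl
  have hinf : {y : ℂ | ![x, y] ∈ O}.Infinite := by
    have hc : Continuous fun y : ℂ => ![x, y] := by fun_prop
    exact infinite_of_mem_nhds (e 1) ((hO.preimage hc).mem_nhds hxO)
  obtain ⟨A, hA⟩ : ∃ A, A = a * x ^ 3 := ⟨_, rfl⟩
  obtain ⟨B, hB⟩ : ∃ B, B = b * x ^ 2 := ⟨_, rfl⟩
  obtain ⟨C, hC⟩ : ∃ C, C = c * x := ⟨_, rfl⟩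
  let P : Polynomial ℂ := .C A + .C B * .X + .C C * .X ^ 2 + .C d * .X ^ 3
  have hP : P = 0 := by
    refine Polynomial.eq_zero_of_infinite_isRoot P (hinf.mono fun y hy => ?_)
    have := h _ hy
    simp only [Matrix.cons_val_zero, Matrix.cons_val_one] at this
    simp only [P, Set.mem_ofPred_eq, Polynomial.IsRoot, Polynomial.eval_add, Polynomial.eval_mul,
      Polynomial.eval_C, Polynomial.eval_X, Polynomial.eval_pow]
    linear_combination this + hA + y * hB + y ^ 2 * hC
  have c0 := congrArg (Polynomial.coeff · 0) hP
  have c1 := congrArg (Polynomial.coeff · 1) hP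
  have c2 := congrArg (Polynomial.coeff · 2) hP
  have c3 := congrArg (Polynomial.coeff · 3) hP
  simp [P, Polynomial.coeff_X, Polynomial.coeff_X_pow, Polynomial.coeff_C] at c0 c1 c2 c3
  refine ⟨?_, ?_, ?_, c3⟩
  · simpa [hx] using hA.symm.trans c0
  · simpa [hx] using hB.symm.trans c1
  · simpa [hx] using hC.symm.trans c2

/-! ### Fibrewise holomorphic functions and the non-quadratic locus. -/

/-- Smooth functions that are holomorphic along the fibres. -/
structure FibHol (S : Set Pt) (u : Pt → ℂ) : Prop where
  sm : Sm S u
  dvBar_eq : ∀ p ∈ S, ∀ k, dvBar k u p = 0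

section FibHol
variable {S : Set Pt} {u v : Pt → ℂ} {p : Pt}

lemma FibHol.mul (hu : FibHol S u) (hv : FibHol S v) : FibHol S fun q => u q * v q :=
  ⟨hu.sm.mul hv.sm, fun p hp k => by
    rw [dvBar_mul hu.sm hv.sm hp, hu.dvBar_eq p hp, hv.dvBar_eq p hp]; ring⟩

lemma FibHol.sub (hu : FibHol S u) (hv : FibHol S v) : FibHol S fun q => u q - v q :=
  ⟨hu.sm.sub hv.sm, fun p hp k => by
    rw [dvBar_eq_wir, wir_sub hu.sm hv.sm hp, ← dvBar_eq_wir, hu.dvBar_eq p hp, hv.dvBar_eq p hp]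
    ring⟩

lemma FibHol.sum (hS : IsOpen S) {u : Fin 2 → Pt → ℂ} (hu : ∀ i, FibHol S (u i)) :
    FibHol S fun q => ∑ i, u i q :=
  ⟨Sm.sum hS fun i => (hu i).sm, fun p hp k => by
    rw [dvBar_sum (fun i => (hu i).sm) hp]
    exact Finset.sum_eq_zero fun i _ => (hu i).dvBar_eq p hp k⟩

lemma FibHol.coord (hS : IsOpen S) (i : Fin 2) : FibHol S fun q => q.2 i :=
  ⟨Sm.coord hS i, fun _ _ _ => dvBar_coord _ _⟩

lemma FibHol.dv_star (hu : FibHol S u) (hp : p ∈ S) (k : Fin 2) :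
    dv k (fun q => star (u q)) p = 0 := by
  rw [CFinsler.dv_star hu.sm hp, hu.dvBar_eq p hp, star_zero]

/-- Differentiating `η̄^h u_h` in `η̄^k` for fibrewise holomorphic `u_h`. -/
lemma FibHol.dvBar_contract (hS : IsOpen S) {u : Fin 2 → Pt → ℂ} (hu : ∀ i, FibHol S (u i))
    (hp : p ∈ S) (k : Fin 2) : dvBar k (fun q => ∑ i, star (q.2 i) * u i q) p = u k p := by
  rw [dvBar_sum (fun i => (Sm.coord hS i).star.mul (hu i).sm) hp]
  simp only [dvBar_mul (Sm.coord hS _).star (hu _).sm hp, dvBar_coord_star,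
    (hu _).dvBar_eq p hp, mul_zero, add_zero, ite_mul, one_mul, zero_mul, Finset.sum_ite_eq',
    Finset.mem_univ, if_true]

end FibHol

/-- The points where the `(2,0)`-part of the fibre Hessian of `L` does not vanish. -/
def nonQuad (f : Pt → ℝ) (Ω : Set C2) : Set Pt :=
  {p | p ∈ sl Ω ∧ ∃ k l, dv k (dv l (energy f)) p ≠ 0}

namespace LocalFinsler

variable {f : Pt → ℝ} {Ω : Set C2} {p : Pt} (h : LocalFinsler f Ω)
include h

lemma energy_ne (hp : p ∈ sl Ω) : energy f p ≠ 0 := by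
  -- The conjugate vector is used because the matrix form is `x* G x`, whereas `L = g_{i j̄} η^i
  -- η̄^j`.
  have := (h.posDef p hp).dotProduct_mulVec_pos (x := star p.2) (by simpa using hp.2)
  refine ne_of_eq_of_ne ?_ this.ne'
  rw [← h.sum_g_star_star hp]
  simp [Matrix.mulVec, dotProduct, gMat, Fin.sum_univ_two]
  ring

lemma isOpen_nonQuad : IsOpen (nonQuad f Ω) := by
  have : nonQuad f Ω = ⋃ k, ⋃ l, sl Ω ∩ (dv k (dv l (energy f))) ⁻¹' {0}ᶜ := by
    ext; simp [nonQuad]; tauto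
  rw [this]
  exact isOpen_iUnion fun k => isOpen_iUnion fun l =>
    ((h.sm_L l).dv k).contDiffOn.continuousOn.isOpen_inter_preimage h.open_sl
      isOpen_compl_singleton

end LocalFinsler

/-! ### Consequences of weak symmetry. -/

/-- The weak symmetry condition for a metric on an open set of `ℂ²`. -/
def WeakSymm (f : Pt → ℝ) (Ω : Set C2) : Prop :=
  ∀ p ∈ sl Ω, ∀ k : Fin 2,
    ∑ r, ∑ h, ∑ j, R f r k h j p * star (p.2 r) * star (p.2 h) * p.2 j =
      ∑ r, ∑ h, ∑ j, R f r j h k p * star (p.2 r) * star (p.2 h) * p.2 j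

/-- The vector field `Pc^l_{m h̄ j} η^m η^j`. -/
def Qc (f : Pt → ℝ) (l s : Fin 2) (p : Pt) : ℂ := ∑ m, ∑ j, Pc f l m s j p * p.2 m * p.2 j

namespace LocalBerwald

variable {f : Pt → ℝ} {Ω : Set C2} {p : Pt} (h : LocalBerwald f Ω)
include h

lemma sum_R_star (j s k : Fin 2) (hp : p ∈ sl Ω) :
    ∑ r, R f r j s k p * star (p.2 r) = ∑ l, dv l (energy f) p * Pc f l j s k p +
      ∑ l, (∑ m, Pc f l m s k p * p.2 m) * dv l (dv j (energy f)) p := by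
  have h1 := fun l => h.sum_g_star l hp
  have h2 := fun l => h.sum_dvg_star l j hp
  simp only [h.R_eq _ _ _ _ hp, ← h1, ← h2]
  simp only [Fin.sum_univ_two]
  ring

/-- In the difference of the two contractions the terms with `L_l` cancel by `Pc_symm`, and on one
side the Hessian term dies because `L_{lj} η^j = 0`. Only the other Hessian term survives. -/
lemma sum_Qc_L2 (hw : WeakSymm f Ω) (k : Fin 2) (hp : p ∈ sl Ω) :
    ∑ l, (∑ s, star (p.2 s) * Qc f l s p) * dv l (dv k (energy f)) p = 0 := by
  have h0 := hw p hp k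
  have h1 := fun j s k => h.sum_R_star j s k hp
  have h2 := fun l s j => h.Pc_symm l k s j hp
  have h3 := fun l => h.sum_L2 l hp
  simp only [Qc, Fin.sum_univ_two] at h0 h1 h3 ⊢
  linear_combination h0
    - star (p.2 0) * p.2 0 * h1 k 0 0 - star (p.2 0) * p.2 1 * h1 k 0 1
    - star (p.2 1) * p.2 0 * h1 k 1 0 - star (p.2 1) * p.2 1 * h1 k 1 1
    + star (p.2 0) * p.2 0 * h1 0 0 k + star (p.2 0) * p.2 1 * h1 1 0 k
    + star (p.2 1) * p.2 0 * h1 0 1 k + star (p.2 1) * p.2 1 * h1 1 1 k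
    - star (p.2 0) * p.2 0 * (dv 0 (energy f) p * h2 0 0 0 + dv 1 (energy f) p * h2 1 0 0)
    - star (p.2 0) * p.2 1 * (dv 0 (energy f) p * h2 0 0 1 + dv 1 (energy f) p * h2 1 0 1)
    - star (p.2 1) * p.2 0 * (dv 0 (energy f) p * h2 0 1 0 + dv 1 (energy f) p * h2 1 1 0)
    - star (p.2 1) * p.2 1 * (dv 0 (energy f) p * h2 0 1 1 + dv 1 (energy f) p * h2 1 1 1)
    + (star (p.2 0) * (Pc f 0 0 0 k p * p.2 0 + Pc f 0 1 0 k p * p.2 1) +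
      star (p.2 1) * (Pc f 0 0 1 k p * p.2 0 + Pc f 0 1 1 k p * p.2 1)) * h3 0
    + (star (p.2 0) * (Pc f 1 0 0 k p * p.2 0 + Pc f 1 1 0 k p * p.2 1) +
      star (p.2 1) * (Pc f 1 0 1 k p * p.2 0 + Pc f 1 1 1 k p * p.2 1)) * h3 1

lemma fibHol_Pc {S : Set Pt} (hS : IsOpen S) (hSl : S ⊆ sl Ω) (l m s k : Fin 2) :
    FibHol S (Pc f l m s k) :=
  ⟨(h.sm_Pc l m s k).mono hS hSl,
    fun _ hp j => (h.vertConst_Pc l m s k).dvBar (h.sm_Pc l m s k) (hSl hp) j⟩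

lemma dv_Pc (l m s k j : Fin 2) (hp : p ∈ sl Ω) : dv j (Pc f l m s k) p = 0 :=
  (h.vertConst_Pc l m s k).dv (h.sm_Pc l m s k) hp j

/-- Both η and `η̄^s Q_s` lie in the kernel of a nonzero 2×2 matrix, so they are parallel. Taking
`∂/∂η̄^s` of this relation on the open set `nonQuad` separates the values of `s`. -/
lemma wedge_Qc (hw : WeakSymm f Ω) (s : Fin 2) (hp : p ∈ nonQuad f Ω) :
    p.2 0 * Qc f 1 s p - p.2 1 * Qc f 0 s p = 0 := by
  have hS := h.isOpen_nonQuad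
  have hSl : nonQuad f Ω ⊆ sl Ω := fun q hq => hq.1
  have hQ : ∀ l s, FibHol (nonQuad f Ω) (Qc f l s) := fun l s =>
    FibHol.sum hS fun m => FibHol.sum hS fun j =>
      ((h.fibHol_Pc hS hSl l m s j).mul (FibHol.coord hS m)).mul (FibHol.coord hS j)
  have hG : ∀ s, FibHol (nonQuad f Ω) fun q => q.2 0 * Qc f 1 s q - q.2 1 * Qc f 0 s q := fun s =>
    ((FibHol.coord hS 0).mul (hQ 1 s)).sub ((FibHol.coord hS 1).mul (hQ 0 s))
  rw [← FibHol.dvBar_contract hS hG hp s, dvBar_congr (v := fun _ => 0) hS ?_ hp s, dvBar_eq_wir,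
    wir_const]
  rintro q ⟨hq, k, l, hkl⟩
  have h1 := h.sum_Qc_L2 hw k hq
  have h2 := h.sum_L2 k hq
  have h3 := fun l => h.L_symm k l hq
  simp only [Fin.sum_univ_two, ← h3] at h1 h2 ⊢
  refine (mul_eq_zero.1 (?_ : dv k (dv l (energy f)) q * _ = 0)).resolve_left hkl
  fin_cases l <;> simp only [Fin.zero_eta, Fin.mk_one]
  · linear_combination (star (q.2 0) * Qc f 1 0 q + star (q.2 1) * Qc f 1 1 q) * h2 - q.2 1 * h1
  · linear_combination q.2 0 * h1 - (star (q.2 0) * Qc f 0 0 q + star (q.2 1) * Qc f 0 1 q) * h2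

/-- These are the coefficients of the cubic `η^0 Q^1_s - η^1 Q^0_s`, whose coefficients are constant
on the fibre. Equivalently `P^l_{m s̄ k} = ½(δ^l_m c_{sk} + δ^l_k c_{sm})` with `c_{sk} = P^k_{k s̄
k}` (no sum). -/
lemma Pc_projective (hw : WeakSymm f Ω) (s : Fin 2) (hp : p ∈ nonQuad f Ω) :
    Pc f 1 0 s 0 p = 0 ∧ 2 * Pc f 1 0 s 1 p = Pc f 0 0 s 0 p ∧
      2 * Pc f 0 0 s 1 p = Pc f 1 1 s 1 p ∧ Pc f 0 1 s 1 p = 0 := by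
  have hO : IsOpen {η : C2 | (p.1, η) ∈ nonQuad f Ω} :=
    h.isOpen_nonQuad.preimage (by fun_prop)
  have := cubic_eq_zero hO (e := p.2) hp (a := Pc f 1 0 s 0 p)
    (b := 2 * Pc f 1 0 s 1 p - Pc f 0 0 s 0 p) (c := Pc f 1 1 s 1 p - 2 * Pc f 0 0 s 1 p)
    (d := -Pc f 0 1 s 1 p) ?_
  · obtain ⟨h0, h1, h2, h3⟩ := this
    exact ⟨h0, by linear_combination h1, by linear_combination -h2, by linear_combination -h3⟩
  intro η hη
  have hq := h.wedge_Qc hw s hη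
  have e : ∀ l m j, Pc f l m s j (p.1, η) = Pc f l m s j p := fun l m j =>
    h.vertConst_Pc l m s j _ hη.1 p hp.1 rfl
  have hs := fun l => h.Pc_symm l 1 s 0 hp.1
  simp only [Qc, Fin.sum_univ_two, e, hs] at hq
  linear_combination hq

lemma Pc_eq_zero_of_nonQuad (hw : WeakSymm f Ω) (hp : p ∈ nonQuad f Ω) (l m s k : Fin 2) :
    Pc f l m s k p = 0 := by
  have hS := h.isOpen_nonQuad
  have hSl : nonQuad f Ω ⊆ sl Ω := fun q hq => hq.1
  have hc : ∀ s k, FibHol (nonQuad f Ω) (Pc f k k s k) := fun s k => h.fibHol_Pc hS hSl _ _ _ _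
  let w : Fin 2 → Pt → ℂ := fun s q => ∑ k, Pc f k k s k q * q.2 k
  have hwS : ∀ s, FibHol (nonQuad f Ω) (w s) := fun s =>
    FibHol.sum hS fun k => (hc s k).mul (FibHol.coord hS k)
  have dvw : ∀ s l, ∀ q ∈ nonQuad f Ω, dv l (w s) q = Pc f l l s l q := by
    intro s l q hq
    rw [dv_sum (fun k => (hc s k).sm.mul (Sm.coord hS k)) hq]
    simp [dv_mul (hc s _).sm (Sm.coord hS _) hq, h.dv_Pc _ _ _ _ _ hq.1, dv_coord]
  -- With `c_{sk} = P^k_{k s̄ k}` and `w_s = c_{sk} η^k`, the projective form gives `2Y_{sk} =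
  -- c_{sk} L + w_s L_k`.
  have hY : ∀ q ∈ nonQuad f Ω, ∀ s k, 2 * Yc f s k q =
      Pc f k k s k q * energy f q + w s q * dv k (energy f) q := by
    intro q hq s k
    obtain ⟨h0, h1, h2, h3⟩ := h.Pc_projective hw s hq
    have hs := fun l => h.Pc_symm l 1 s 0 hq.1
    rw [Yc, ← h.euler hq.1]
    fin_cases k <;> simp only [w, Fin.zero_eta, Fin.mk_one, Fin.sum_univ_two, hs, h0, h3, ← h1, ← h2]
      <;> ring
  have hY2 : ∀ q ∈ nonQuad f Ω, ∀ s k, Pc f k k s k q * energy f q + w s q * dv k (energy f) q =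
      star (Pc f s s k s q) * energy f q + star (w k q) * star (dv s (energy f) q) := by
    intro q hq s k
    rw [← hY q hq, h.Yc_herm s k hq.1]
    have := congrArg star (hY q hq k s)
    rw [star_mul', star_add, star_mul', star_mul', star_energy] at this
    rw [← this]; simp
  let Φ : Pt → ℂ := fun q => ∑ s, star (q.2 s) * w s q
  -- Contracting `hY2` with `η̄^s η^k` gives `2ΦL = 2Φ̄L`, so `Φ` is real. Its two expressions give
  -- two formulas for `∂Φ/∂η^l`.
  have hΦ : ∀ q ∈ nonQuad f Ω, Φ q = ∑ s, q.2 s * star (w s q) := by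
    intro q hq
    have h1 := h.euler hq.1
    have h2 := h.eulerBar hq.1
    simp only [h.dvBar_energy _ hq.1] at h2
    have h3 := hY2 q hq
    refine mul_right_cancel₀ (mul_ne_zero two_ne_zero (h.energy_ne hq.1)) ?_
    simp only [Φ, w, Fin.sum_univ_two, star_add, star_mul'] at h1 h2 h3 ⊢
    linear_combination star (q.2 0) * q.2 0 * h3 0 0 + star (q.2 0) * q.2 1 * h3 0 1 +
      star (q.2 1) * q.2 0 * h3 1 0 + star (q.2 1) * q.2 1 * h3 1 1
      - (star (q.2 0) * (Pc f 0 0 0 0 q * q.2 0 + Pc f 1 1 0 1 q * q.2 1) +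
        star (q.2 1) * (Pc f 0 0 1 0 q * q.2 0 + Pc f 1 1 1 1 q * q.2 1)) * h1
      + (q.2 0 * (star (Pc f 0 0 0 0 q) * star (q.2 0) + star (Pc f 1 1 0 1 q) * star (q.2 1)) +
        q.2 1 * (star (Pc f 0 0 1 0 q) * star (q.2 0) + star (Pc f 1 1 1 1 q) * star (q.2 1))) * h2
  have dvΦ1 : ∀ q ∈ nonQuad f Ω, ∀ l, dv l Φ q = ∑ s, star (q.2 s) * Pc f l l s l q := by
    intro q hq l
    rw [dv_sum (fun s => (Sm.coord hS s).star.mul (hwS s).sm) hq]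
    refine Finset.sum_congr rfl fun s _ => ?_
    rw [dv_mul (Sm.coord hS s).star (hwS s).sm hq, dv_coord_star, dvw s l q hq]; ring
  have dvΦ2 : ∀ q ∈ nonQuad f Ω, ∀ l, dv l Φ q = star (w l q) := by
    intro q hq l
    rw [dv_congr hS hΦ hq l, dv_sum (fun s => (Sm.coord hS s).mul (hwS s).sm.star) hq]
    simp only [dv_mul (Sm.coord hS _) (hwS _).sm.star hq, dv_coord, (hwS _).dv_star hq, mul_zero,
      add_zero, ite_mul, one_mul, zero_mul, Finset.sum_ite_eq', Finset.mem_univ, if_true]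
  -- Contract `hY2` with `η̄^s` only. As `∂_kΦ = w̄_k`, this says that `Φ` and `L` have the same
  -- logarithmic derivative.
  have hwE : ∀ q ∈ nonQuad f Ω, ∀ k, star (w k q) * energy f q = Φ q * dv k (energy f) q := by
    intro q hq k
    have h1 := h.eulerBar hq.1
    simp only [h.dvBar_energy _ hq.1] at h1
    have h2 := (dvΦ1 q hq k).symm.trans (dvΦ2 q hq k)
    have h3 := fun s => hY2 q hq s k
    have h4 : star (w k q) = ∑ s, star (Pc f s s k s q) * star (q.2 s) := by
      simp only [w, star_sum, star_mul']
    simp only [Φ, Fin.sum_univ_two] at h1 h2 h3 h4 ⊢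
    linear_combination energy f q * h2 - star (q.2 0) * h3 0 - star (q.2 1) * h3 1
      - star (w k q) * h1 + energy f q * h4
  -- Differentiate `hwE` once more; `w̄_l` is antiholomorphic. After multiplication by `L` the
  -- first-order terms cancel, leaving `Φ L L_{kl} = 0`.
  have hΦ0 : ∀ q ∈ nonQuad f Ω, Φ q = 0 := by
    rintro q hq
    obtain ⟨k, l, hkl⟩ := hq.2
    have hΦS : Sm (nonQuad f Ω) Φ := Sm.sum hS fun s => (Sm.coord hS s).star.mul (hwS s).sm
    have h1 := dv_congr hS (fun r hr => hwE r hr l) hq k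
    rw [dv_mul (hwS l).sm.star (h.sm_energy.mono hS hSl) hq,
      dv_mul hΦS ((h.sm_L l).mono hS hSl) hq, (hwS l).dv_star hq, dvΦ2 q hq] at h1
    refine (mul_eq_zero.1 (?_ : _ * Φ q = 0)).resolve_left
      (mul_ne_zero (h.energy_ne hq.1) hkl)
    linear_combination -energy f q * h1 + dv k (energy f) q * hwE q hq l
      - dv l (energy f) q * hwE q hq k
  have hw0 : ∀ q ∈ nonQuad f Ω, ∀ k, w k q = 0 := by
    intro q hq k
    have := hwE q hq k
    rw [hΦ0 q hq, zero_mul] at this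
    simpa [h.energy_ne hq.1] using this
  have hc0 : ∀ s l, Pc f l l s l p = 0 := by
    intro s l
    rw [← dvw s l p hp, dv_congr (v := fun _ => 0) hS (fun q hq => hw0 q hq s) hp, dv_eq_wir,
      wir_const]
  obtain ⟨h0, h1, h2, h3⟩ := h.Pc_projective hw s hp
  have hs := fun l => h.Pc_symm l 1 s 0 hp.1
  have e0 := hc0 s 0
  have e1 := hc0 s 1
  rw [e0] at h1
  rw [e1] at h2
  have h1' : Pc f 1 0 s 1 p = 0 := by simpa using h1
  have h2' : Pc f 0 0 s 1 p = 0 := by simpa using h2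
  fin_cases l <;> fin_cases m <;> fin_cases k <;>
    simp only [Fin.zero_eta, Fin.mk_one, hs, h0, h3, e0, e1, h1', h2']

end LocalBerwald

/-! ### The curvature invariants in the Berwald frame -/

section deltaBar

variable {f : Pt → ℝ} {S : Set Pt} {u v : Pt → ℂ} {p : Pt}

lemma deltaBar_congr (hS : IsOpen S) (h : ∀ q ∈ S, u q = v q) (hp : p ∈ S) (s : Fin 2) :
    deltaBar f s u p = deltaBar f s v p := by
  simp only [deltaBar, dzBar_congr hS h hp, dvBar_congr hS h hp]

lemma deltaBar_mul (hu : Sm S u) (hv : Sm S v) (hp : p ∈ S) (s : Fin 2) :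
    deltaBar f s (fun q => u q * v q) p = deltaBar f s u p * v p + u p * deltaBar f s v p := by
  simp only [deltaBar, dzBar_mul hu hv hp, dvBar_mul hu hv hp, Fin.sum_univ_two]; ring

lemma deltaBar_sub (hu : Sm S u) (hv : Sm S v) (hp : p ∈ S) (s : Fin 2) :
    deltaBar f s (fun q => u q - v q) p = deltaBar f s u p - deltaBar f s v p := by
  simp only [deltaBar, dzBar_eq_wir, dvBar_eq_wir, wir_sub hu hv hp, Fin.sum_univ_two]; ring

lemma deltaBar_sum {u : Fin 2 → Pt → ℂ} (hu : ∀ i, Sm S (u i)) (hp : p ∈ S) (s : Fin 2) :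
    deltaBar f s (fun q => ∑ i, u i q) p = ∑ i, deltaBar f s (u i) p := by
  simp only [deltaBar, dzBar_sum hu hp, dvBar_sum hu hp]
  simp only [Fin.sum_univ_two]
  ring

lemma deltaBar_star (hu : Sm S u) (hp : p ∈ S) (s : Fin 2) :
    deltaBar f s (fun q => star (u q)) p = star (delta f s u p) := by
  simp only [deltaBar, delta, dzBar_star hu hp, dvBar_star hu hp, star_sub, star_sum, star_mul']

end deltaBar

/-- `u` is smooth and an eigenfunction at `p` of the derivation `δ_s̄`, with eigenvalue `c`. -/
structure HasWeight (f : Pt → ℝ) (S : Set Pt) (p : Pt) (s : Fin 2) (c : ℂ) (u : Pt → ℂ) :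
    Prop where
  sm : Sm S u
  eq : deltaBar f s u p = c * u p

namespace HasWeight

variable {f : Pt → ℝ} {S : Set Pt} {u v : Pt → ℂ} {p : Pt} {s : Fin 2} {c d : ℂ}

lemma mul (hp : p ∈ S) (hu : HasWeight f S p s c u) (hv : HasWeight f S p s d v) :
    HasWeight f S p s (c + d) fun q => u q * v q :=
  ⟨hu.sm.mul hv.sm, by rw [deltaBar_mul hu.sm hv.sm hp, hu.eq, hv.eq]; ring⟩

lemma sum (hS : IsOpen S) (hp : p ∈ S) {u : Fin 2 → Pt → ℂ}
    (hu : ∀ i, HasWeight f S p s c (u i)) : HasWeight f S p s c fun q => ∑ i, u i q :=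
  ⟨Sm.sum hS fun i => (hu i).sm, by
    rw [deltaBar_sum (fun i => (hu i).sm) hp, Finset.mul_sum]
    exact Finset.sum_congr rfl fun i _ => (hu i).eq⟩

lemma div (hp : p ∈ S) (hu : HasWeight f S p s c u) (hv : HasWeight f S p s d v)
    (h0 : ∀ q ∈ S, v q ≠ 0) : HasWeight f S p s (c - d) fun q => u q / v q := by
  have hsm := hu.sm.div hv.sm h0
  refine ⟨hsm, ?_⟩
  have h1 := deltaBar_congr (f := f) (u := fun q => u q / v q * v q) hu.sm.isOpen
    (fun q hq => div_mul_cancel₀ (u q) (h0 q hq)) hp s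
  rw [deltaBar_mul hsm hv.sm hp, hu.eq, hv.eq] at h1
  have h2 := h0 p hp
  field_simp
  field_simp at h1
  linear_combination h1

lemma neg (hu : HasWeight f S p s c u) : HasWeight f S p s c fun q => -u q := by
  refine ⟨hu.sm.neg, ?_⟩
  have := hu.eq
  simp only [deltaBar, dzBar_eq_wir, dvBar_eq_wir, wir_neg, Fin.sum_univ_two] at this ⊢
  linear_combination -this

lemma congr (hp : p ∈ S) (hu : HasWeight f S p s c u) (h : ∀ q ∈ S, v q = u q) :
    HasWeight f S p s c v :=
  ⟨hu.sm.congr h, by rw [deltaBar_congr hu.sm.isOpen h hp, hu.eq, h p hp]⟩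

lemma of_eq (hu : HasWeight f S p s c u) (h : c = d) : HasWeight f S p s d u := h ▸ hu

end HasWeight

/-! ### Weights of the frame vectors under `δ_s̄`. -/

namespace LocalFinsler

variable {f : Pt → ℝ} {Ω : Set C2} {p : Pt} (h : LocalFinsler f Ω)
include h

lemma f_ne (hp : p ∈ sl Ω) : (f p : ℂ) ≠ 0 := fun h0 => h.energy_ne hp (by simp [energy, h0])

omit h in
lemma f_mul_f (p : Pt) : (f p : ℂ) * f p = energy f p := by simp [energy, sq]

lemma sm_f : Sm (sl Ω) fun q => (f q : ℂ) := by
  refine ⟨h.open_sl, (ofRealCLM.contDiff (n := ∞)).comp_contDiffOn ?_⟩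
  have h1 : ∀ q ∈ sl Ω, f q ^ 2 ≠ 0 := fun q hq h0 => h.energy_ne hq (by simp [energy, h0])
  exact (h.smooth.sqrt h1).congr fun q _ => (Real.sqrt_sq (h.nonneg q)).symm

lemma det_im (hp : p ∈ sl Ω) : ((gMat f p).det.re : ℂ) = (gMat f p).det :=
  Complex.ext rfl (Complex.pos_iff.1 (h.det_pos hp)).2

lemma sqrtDet_mul_self (hp : p ∈ sl Ω) : sqrtDet f p * sqrtDet f p = (gMat f p).det := by
  rw [sqrtDet, ← ofReal_mul, Real.mul_self_sqrt (Complex.pos_iff.1 (h.det_pos hp)).1.le,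
    h.det_im hp]

lemma sqrtDet_ne (hp : p ∈ sl Ω) : sqrtDet f p ≠ 0 := fun h0 =>
  h.det_ne hp (by rw [← h.sqrtDet_mul_self hp, h0, mul_zero])

lemma sm_sqrtDet : Sm (sl Ω) (sqrtDet f) := by
  refine ⟨h.open_sl, (ofRealCLM.contDiff (n := ∞)).comp_contDiffOn ?_⟩
  have h1 : ContDiffOn ℝ ∞ (fun q => (gMat f q).det.re) (sl Ω) :=
    (reCLM.contDiff (n := ∞)).comp_contDiffOn h.sm_det.contDiffOn
  exact h1.sqrt fun q hq => (Complex.pos_iff.1 (h.det_pos hq)).1.ne'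

lemma lLo_eq (i : Fin 2) (hp : p ∈ sl Ω) : lLo f i p = dv i (energy f) p / f p := by
  rw [← h.sum_g_star i hp, lLo, Finset.sum_div]
  refine Finset.sum_congr rfl fun j _ => ?_
  simp [lUp, mul_div_assoc]

lemma sum_lUp_lLo (hp : p ∈ sl Ω) : ∑ i, lUp f i p * lLo f i p = 1 := by
  have h1 := h.euler hp
  have h2 := h.f_ne hp
  simp only [h.lLo_eq _ hp, lUp, Fin.sum_univ_two] at h1 ⊢
  field_simp
  rw [h1, ← f_mul_f, sq]

lemma star_lLo (i : Fin 2) (hp : p ∈ sl Ω) : star (lLo f i p) = ∑ j, g f j i p * lUp f j p := by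
  simp only [lLo, star_sum, star_mul', star_star, h.star_g _ _ hp]

omit h in
lemma star_sqrtDet (p : Pt) : star (sqrtDet f p) = sqrtDet f p := by simp [sqrtDet]

lemma mLo_zero (hp : p ∈ sl Ω) : mLo f 0 p = -(sqrtDet f p * lUp f 1 p) := by
  have h1 := h.star_lLo 0 hp
  have h2 := h.star_lLo 1 hp
  have h3 := h.sqrtDet_mul_self hp
  have h4 := h.sqrtDet_ne hp
  simp only [mLo, mUp, star_div₀, star_sqrtDet, Fin.sum_univ_two, Matrix.cons_val_zero,
    Matrix.cons_val_one, star_neg, h1, h2]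
  simp only [Matrix.det_fin_two, gMat, Matrix.of_apply] at h3
  field_simp
  linear_combination lUp f 1 p * h3

lemma mLo_one (hp : p ∈ sl Ω) : mLo f 1 p = sqrtDet f p * lUp f 0 p := by
  have h1 := h.star_lLo 0 hp
  have h2 := h.star_lLo 1 hp
  have h3 := h.sqrtDet_mul_self hp
  have h4 := h.sqrtDet_ne hp
  simp only [mLo, mUp, star_div₀, star_sqrtDet, Fin.sum_univ_two, Matrix.cons_val_zero,
    Matrix.cons_val_one, star_neg, h1, h2]
  simp only [Matrix.det_fin_two, gMat, Matrix.of_apply] at h3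
  field_simp
  linear_combination -lUp f 0 p * h3

/-- Completeness of the Berwald frame. -/
lemma frame_complete (i j : Fin 2) (hp : p ∈ sl Ω) :
    lUp f j p * lLo f i p + mUp f j p * mLo f i p = if i = j then 1 else 0 := by
  have h1 := h.sum_lUp_lLo hp
  have h4 := h.sqrtDet_ne hp
  rw [Fin.sum_univ_two] at h1
  fin_cases i <;> fin_cases j <;>
    simp [mUp, h.mLo_zero hp, h.mLo_one hp] <;> field_simp <;>
    first | linear_combination h1 | ring

/-- The frame turns `l^j l_i + m^j m_i` into a trace. This trace is also the logarithmic derivative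
of `det g`, which is why `V̄ + H̄` occurs in `W`. -/
lemma V_add_H (hp : p ∈ sl Ω) : V f p + H f p = ∑ k, mUp f k p * ∑ j, Lc f j j k p := by
  have h1 := fun i j => h.frame_complete i j hp
  have h00 := h1 0 0
  have h01 := h1 0 1
  have h10 := h1 1 0
  have h11 := h1 1 1
  simp only [if_true, Fin.isValue, zero_ne_one, one_ne_zero, if_false] at h00 h01 h10 h11
  simp only [V, H, Fin.sum_univ_two]
  linear_combination
    (mUp f 0 p * Lc f 0 0 0 p + mUp f 1 p * Lc f 0 0 1 p) * h00 +
    (mUp f 0 p * Lc f 0 1 0 p + mUp f 1 p * Lc f 0 1 1 p) * h01 +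
    (mUp f 0 p * Lc f 1 0 0 p + mUp f 1 p * Lc f 1 0 1 p) * h10 +
    (mUp f 0 p * Lc f 1 1 0 p + mUp f 1 p * Lc f 1 1 1 p) * h11

lemma deltaBar_g (s j n : Fin 2) (hp : p ∈ sl Ω) :
    deltaBar f s (g f j n) p = ∑ i, star (Lc f i n s p) * g f j i p := by
  rw [deltaBar_congr h.open_sl (fun q hq => (h.star_g n j hq).symm) hp s,
    deltaBar_star (h.sm_g n j) hp, ← h.Lc_g n s j hp, star_sum]
  exact Finset.sum_congr rfl fun i _ => by rw [star_mul', h.star_g i j hp]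

lemma deltaBar_det (s : Fin 2) (hp : p ∈ sl Ω) :
    deltaBar f s (fun q => (gMat f q).det) p = star (∑ j, Lc f j j s p) * (gMat f p).det := by
  simp only [Matrix.det_fin_two, gMat, Matrix.of_apply]
  rw [deltaBar_sub ((h.sm_g 0 0).mul (h.sm_g 1 1)) ((h.sm_g 0 1).mul (h.sm_g 1 0)) hp,
    deltaBar_mul (h.sm_g 0 0) (h.sm_g 1 1) hp, deltaBar_mul (h.sm_g 0 1) (h.sm_g 1 0) hp]
  simp only [h.deltaBar_g _ _ _ hp, Fin.sum_univ_two, star_add]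
  ring

lemma weight_sqrtDet (s : Fin 2) (hp : p ∈ sl Ω) :
    HasWeight f (sl Ω) p s (star (∑ j, Lc f j j s p) / 2) (sqrtDet f) := by
  refine ⟨h.sm_sqrtDet, ?_⟩
  have h1 := h.deltaBar_det s hp
  rw [← deltaBar_congr h.open_sl (fun q hq => h.sqrtDet_mul_self hq) hp,
    deltaBar_mul h.sm_sqrtDet h.sm_sqrtDet hp, ← h.sqrtDet_mul_self hp] at h1
  refine mul_left_cancel₀ (h.sqrtDet_ne hp) ?_
  linear_combination h1 / 2

lemma weight_coord (s i : Fin 2) : HasWeight f (sl Ω) p s 0 fun q => q.2 i :=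
  ⟨h.sm_coord i, by simp [deltaBar, dzBar_coord, dvBar_coord]⟩

lemma deltaBar_energy (s : Fin 2) (hp : p ∈ sl Ω) : deltaBar f s (energy f) p = 0 := by
  rw [deltaBar, h.dzBar_energy s hp, h.dz_energy s hp, star_sum, sub_eq_zero]
  exact Finset.sum_congr rfl fun j _ => by rw [star_mul', h.dvBar_energy j hp]

lemma weight_f (s : Fin 2) (hp : p ∈ sl Ω) : HasWeight f (sl Ω) p s 0 fun q => (f q : ℂ) := by
  refine ⟨h.sm_f, ?_⟩
  have h1 := h.deltaBar_energy s hp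
  rw [← deltaBar_congr h.open_sl (fun q _ => f_mul_f q) hp, deltaBar_mul h.sm_f h.sm_f hp] at h1
  refine mul_left_cancel₀ (h.f_ne hp) ?_
  linear_combination h1 / 2

lemma weight_lUp (s i : Fin 2) (hp : p ∈ sl Ω) : HasWeight f (sl Ω) p s 0 (lUp f i) :=
  ((h.weight_coord s i).div hp (h.weight_f s hp) fun _ hq => h.f_ne hq).of_eq (sub_zero 0)

lemma weight_mLo (s i : Fin 2) (hp : p ∈ sl Ω) :
    HasWeight f (sl Ω) p s (star (∑ j, Lc f j j s p) / 2) (mLo f i) := by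
  fin_cases i
  · exact (((h.weight_sqrtDet s hp).mul hp (h.weight_lUp s 1 hp)).neg.congr hp
      fun q hq => h.mLo_zero hq).of_eq (add_zero _)
  · exact (((h.weight_sqrtDet s hp).mul hp (h.weight_lUp s 0 hp)).congr hp
      fun q hq => h.mLo_one hq).of_eq (add_zero _)

end LocalFinsler

namespace LocalBerwald

variable {f : Pt → ℝ} {Ω : Set C2} {p : Pt} (h : LocalBerwald f Ω)
include h

/-- By `dzBar_L`, `δ_s̄` annihilates `L_i`; this is where the Berwald condition enters the frame
computation. -/
lemma weight_lLo (s i : Fin 2) (hp : p ∈ sl Ω) : HasWeight f (sl Ω) p s 0 (lLo f i) := by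
  have h1 : HasWeight f (sl Ω) p s 0 (dv i (energy f)) := by
    refine ⟨h.sm_L i, ?_⟩
    rw [deltaBar, h.dzBar_L i s hp, zero_mul, sub_eq_zero]
    exact Finset.sum_congr rfl fun j _ => by rw [h.g_eq i j hp]
  exact ((h1.div hp (h.weight_f s hp) fun _ hq => h.f_ne hq).congr hp
    fun q hq => h.lLo_eq i hq).of_eq (sub_zero 0)

lemma weight_mUp (s i : Fin 2) (hp : p ∈ sl Ω) :
    HasWeight f (sl Ω) p s (-(star (∑ j, Lc f j j s p) / 2)) (mUp f i) := by
  have h0 : ∀ q ∈ sl Ω, sqrtDet f q ≠ 0 := fun q hq => h.sqrtDet_ne hq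
  fin_cases i
  · exact ((h.weight_lLo s 1 hp).neg.div hp (h.weight_sqrtDet s hp) h0).of_eq (zero_sub _)
  · exact ((h.weight_lLo s 0 hp).div hp (h.weight_sqrtDet s hp) h0).of_eq (zero_sub _)

variable (hP : ∀ l m s k, Pc f l m s k p = 0)
include hP

lemma R_eq_zero (hp : p ∈ sl Ω) (r j s k : Fin 2) : R f r j s k p = 0 := by
  simp [h.R_eq r j s k hp, hP]

lemma weight_Lc (s i j k : Fin 2) (hp : p ∈ sl Ω) : HasWeight f (sl Ω) p s 0 (Lc f i j k) :=
  ⟨h.sm_Lc i j k, by rw [h.deltaBar_Lc i j k s hp, hP]; simp⟩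

lemma weight_contract (s : Fin 2) (hp : p ∈ sl Ω) {a b c : ℂ} {x y w : Fin 2 → Pt → ℂ}
    (hx : ∀ i, HasWeight f (sl Ω) p s a (x i)) (hy : ∀ i, HasWeight f (sl Ω) p s b (y i))
    (hw : ∀ i, HasWeight f (sl Ω) p s c (w i)) :
    HasWeight f (sl Ω) p s (a + b + c)
      fun q => ∑ i, ∑ j, ∑ k, x j q * y k q * w i q * Lc f i j k q :=
  HasWeight.sum h.open_sl hp fun i => HasWeight.sum h.open_sl hp fun j =>
    HasWeight.sum h.open_sl hp fun k =>
      ((((hx j).mul hp (hy k)).mul hp (hw i)).mul hp (h.weight_Lc hP s i j k hp)).of_eq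
        (add_zero _)

lemma K_eq_zero (hp : p ∈ sl Ω) : K f p = 0 := by
  have h1 : ∀ s, deltaBar f s (J f) p = 0 := by
    intro s
    have := (h.weight_contract hP s hp (fun i => h.weight_lUp s i hp)
      (fun i => h.weight_lUp s i hp) fun i => h.weight_lLo s i hp).eq
    rw [zero_add, zero_add, zero_mul] at this
    exact this
  simp [K, h1]

/-- In `E` the weights of `m^k` and `m_i` cancel, while `H` keeps one uncompensated `m^j`. Its
weight, contracted with `m^{s̄}`, yields exactly the term `½H(V̄ + H̄)`. -/
lemma W_eq_zero (hp : p ∈ sl Ω) : W f p = 0 := by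
  have hE : ∀ s, deltaBar f s (E f) p = 0 := by
    intro s
    have := (h.weight_contract hP s hp (fun i => h.weight_lUp s i hp)
      (fun i => h.weight_mUp s i hp) fun i => h.weight_mLo s i hp).eq
    rw [zero_add, neg_add_cancel, zero_mul] at this
    exact this
  have hH : ∀ s, deltaBar f s (H f) p = -(star (∑ j, Lc f j j s p) / 2) * H f p := by
    intro s
    have := (h.weight_contract hP s hp (fun i => h.weight_mUp s i hp)
      (fun i => h.weight_mUp s i hp) fun i => h.weight_mLo s i hp).eq
    rw [neg_add_cancel_right] at this
    exact this
  have h1 := congrArg star (h.V_add_H hp)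
  simp only [W, hE, hH, zero_mul, Finset.sum_const_zero, mul_zero, sub_zero]
  simp only [star_add, Fin.sum_univ_two, star_mul'] at h1 ⊢
  linear_combination (-1 / 2 : ℂ) * H f p * h1

end LocalBerwald

/-! ### Metrics that are Hermitian on a fibre -/

/-- `F²` is a Hermitian form on the fibre over `z`. -/
def HermAt (f : Pt → ℝ) (z : C2) : Prop :=
  ∃ c : Fin 2 → Fin 2 → ℂ, ∀ η : C2, energy f (z, η) = ∑ i, ∑ j, c i j * η i * star (η j)

/-! ### Vertical derivatives along a single fibre. -/

section Fibre

variable {Ω : Set C2} {u v : Pt → ℂ} {p : Pt}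

lemma Sm.hasFDerivAt_fibre {S : Set Pt} (hu : Sm S u) (hp : p ∈ S) :
    HasFDerivAt (fun η => u (p.1, η))
      ((fderiv ℝ u p).comp ((0 : C2 →L[ℝ] C2).prod (.id ℝ C2))) p.2 := by
  have h1 : HasFDerivAt (fun η : C2 => ((p.1, η) : Pt)) ((0 : C2 →L[ℝ] C2).prod (.id ℝ C2)) p.2 :=
    (hasFDerivAt_const _ _).prodMk (hasFDerivAt_id _)
  exact (show HasFDerivAt u (fderiv ℝ u p) (p.1, p.2) from (hu.diffAt hp).hasFDerivAt).comp p.2 h1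

/-- `HermAt` gives information on one fibre only, where congruence on an open set of `Pt` is
unavailable; vertical derivatives see just the restriction to the fibre. -/
lemma fderiv_fibre_congr (hu : Sm (sl Ω) u) (hv : Sm (sl Ω) v)
    (h : ∀ q ∈ sl Ω, q.1 = p.1 → u q = v q) (hp : p ∈ sl Ω) (w : C2) :
    fderiv ℝ u p (0, w) = fderiv ℝ v p (0, w) := by
  have e : (fun η => u (p.1, η)) =ᶠ[nhds p.2] fun η => v (p.1, η) := by
    filter_upwards [isOpen_ne.mem_nhds hp.2] with η hη
    exact h (p.1, η) ⟨hp.1, hη⟩ rfl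
  have h1 := (hu.hasFDerivAt_fibre hp).fderiv
  rw [e.fderiv_eq, (hv.hasFDerivAt_fibre hp).fderiv] at h1
  exact (congrArg (fun L : C2 →L[ℝ] ℂ => L w) h1).symm

lemma dv_fibre_congr (hu : Sm (sl Ω) u) (hv : Sm (sl Ω) v)
    (h : ∀ q ∈ sl Ω, q.1 = p.1 → u q = v q) (hp : p ∈ sl Ω) (k : Fin 2) :
    dv k u p = dv k v p := by
  rw [dv, dv, fderiv_fibre_congr hu hv h hp, fderiv_fibre_congr hu hv h hp]

lemma dvBar_fibre_congr (hu : Sm (sl Ω) u) (hv : Sm (sl Ω) v)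
    (h : ∀ q ∈ sl Ω, q.1 = p.1 → u q = v q) (hp : p ∈ sl Ω) (k : Fin 2) :
    dvBar k u p = dvBar k v p := by
  rw [dvBar, dvBar, fderiv_fibre_congr hu hv h hp, fderiv_fibre_congr hu hv h hp]

end Fibre

namespace LocalFinsler

variable {f : Pt → ℝ} {Ω : Set C2} {p : Pt} (h : LocalFinsler f Ω)
include h

/-- On a Hermitian fibre the `(2,0)`-part of the Hessian of `L` vanishes. -/
lemma L2_eq_zero_of_hermAt (hp : p ∈ sl Ω) (hH : HermAt f p.1) (k l : Fin 2) :
    dv k (dv l (energy f)) p = 0 := by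
  obtain ⟨c, hc⟩ := hH
  have hO := h.open_sl
  have s1 : ∀ i j, Sm (sl Ω) fun q => c i j * q.2 i := fun i j =>
    (Sm.const hO _).mul (Sm.coord hO i)
  have s2 : ∀ i j, Sm (sl Ω) fun q => c i j * q.2 i * star (q.2 j) := fun i j =>
    (s1 i j).mul (Sm.coord hO j).star
  have s3 : ∀ i, Sm (sl Ω) fun q => ∑ j, c i j * q.2 i * star (q.2 j) := fun i =>
    Sm.sum hO fun j => s2 i j
  have s4 : ∀ j, Sm (sl Ω) fun q => c l j * star (q.2 j) := fun j =>
    (Sm.const hO _).mul (Sm.coord hO j).star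
  have c0 : ∀ (c : ℂ) (q : Pt) (k : Fin 2), dv k (fun _ => c) q = 0 := fun c q k => by
    rw [dv_eq_wir, wir_const]
  have h1 : ∀ q ∈ sl Ω, q.1 = p.1 → dv l (energy f) q = ∑ j, c l j * star (q.2 j) := by
    intro q hq hqp
    rw [dv_fibre_congr h.sm_energy (Sm.sum hO s3)
      (fun r _ hrq => by rw [← hc r.2, ← hqp, ← hrq]) hq, dv_sum s3 hq]
    simp only [dv_sum (s2 _) hq, dv_mul (s1 _ _) (Sm.coord hO _).star hq,
      dv_mul (Sm.const hO _) (Sm.coord hO _) hq, dv_coord, dv_coord_star, c0]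
    fin_cases l <;> simp
  rw [dv_fibre_congr (h.sm_L l) (Sm.sum hO s4) h1 hp, dv_sum s4 hp]
  simp only [dv_mul (Sm.const hO _) (Sm.coord hO _).star hp, dv_coord_star, c0]
  simp

/-- If the `(2,0)`-part of the Hessian of `L` vanishes on a fibre, the fibre is Hermitian. -/
lemma hermAt_of_L2_eq_zero {z : C2} (hz : z ∈ Ω)
    (h0 : ∀ p ∈ sl Ω, p.1 = z → ∀ k l, dv k (dv l (energy f)) p = 0) : HermAt f z := by
  -- `∂_k g_{i j̄} = ∂L_{ki}/∂η̄^j = 0`; conjugation then kills the other derivatives, so `g` is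
  -- constant on the connected set `ℂ² ∖ {0}`.
  have dvg : ∀ p ∈ sl Ω, p.1 = z → ∀ i j k, dv k (g f i j) p = 0 := by
    intro p hp hpz i j k
    have e : dvBar j (dv k (dv i (energy f))) p = dv k (dvBar j (dv i (energy f))) p := by
      simp only [dvBar_eq_wir, dv_eq_wir k]; exact wir_comm (h.sm_L i) hp
    rw [dv_congr h.open_sl (fun q hq => h.g_eq i j hq) hp, ← e,
      dvBar_fibre_congr ((h.sm_L i).dv k) (Sm.const h.open_sl 0)
        (fun q hq hqp => h0 q hq (hqp.trans hpz) k i) hp, dvBar_eq_wir, wir_const]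
  have dvBarg : ∀ p ∈ sl Ω, p.1 = z → ∀ i j k, dvBar k (g f i j) p = 0 := by
    intro p hp hpz i j k
    rw [dvBar_congr h.open_sl (fun q hq => (h.star_g j i hq).symm) hp, dvBar_star (h.sm_g j i) hp,
      dvg p hp hpz, star_zero]
  let e : C2 := fun _ => 1
  have he : e ≠ 0 := fun h => one_ne_zero (congrFun h 0)
  have hconst : ∀ i j, ∀ η : C2, η ≠ 0 → g f i j (z, η) = g f i j (z, e) := by
    intro i j η hη
    have hconn : IsPreconnected ({0}ᶜ : Set C2) := by
      refine (isConnected_compl_singleton_of_one_lt_rank (E := C2) ?_ 0).isPreconnected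
      have : Module.finrank ℝ C2 = 4 := by
        rw [Module.finrank_pi_fintype]; simp
      rw [← Module.finrank_eq_rank, this]
      norm_num
    have hd : ∀ η : C2, η ≠ 0 → HasFDerivAt (fun η => g f i j (z, η)) (0 : C2 →L[ℝ] ℂ) η := by
      intro η hη
      have hp : ((z, η) : Pt) ∈ sl Ω := ⟨hz, hη⟩
      convert (h.sm_g i j).hasFDerivAt_fibre hp using 1
      ext w
      simp [fderiv_eq_wir, wir_I_vec, wir_neg_I_vec, dvg _ hp rfl, dvBarg _ hp rfl]
    exact isOpen_compl_singleton.is_const_of_fderiv_eq_zero hconn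
      (fun η hη => (hd η hη).differentiableAt.differentiableWithinAt)
      (fun η hη => (hd η hη).fderiv) hη he
  refine ⟨fun i j => g f i j (z, e), fun η => ?_⟩
  by_cases hη : η = 0
  · have := h.hom z hz 0 0
    simp only [zero_smul, norm_zero, zero_mul] at this
    simp [hη, energy, this]
  · rw [← h.sum_g_star_star (show ((z, η) : Pt) ∈ sl Ω from ⟨hz, hη⟩)]
    simp only [hconst _ _ η hη, Fin.sum_univ_two]
    ring

/-- Lowering the index of `C` gives `l_i C^i_{kj} = L_{kj}/F`, so `A` only sees the Hessian
`L_{kj}`. -/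
lemma A_eq_zero (hp : p ∈ sl Ω) (h0 : ∀ k l, dv k (dv l (energy f)) p = 0) : A f p = 0 := by
  have h1 : ∀ k j, ∑ i, lLo f i p * Cc f i k j p = 0 := by
    intro k j
    have h2 := h.sum_dvg_star j k hp
    have h3 := fun n => h.Cc_g k j n hp
    have h4 := h.f_ne hp
    rw [h0] at h2
    simp only [lLo, lUp, star_div₀, star_def, conj_ofReal, Fin.sum_univ_two] at h2 h3 ⊢
    field_simp
    linear_combination h2 + starRingEnd ℂ (p.2 0) * h3 0 + starRingEnd ℂ (p.2 1) * h3 1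
  rw [A]
  refine Finset.sum_eq_zero fun j _ => Finset.sum_eq_zero fun k _ => ?_
  simp only [mul_assoc, ← Finset.mul_sum, h1, mul_zero]

end LocalFinsler

/-! ### Parallel transport of a Berwald metric -/

lemma HermAt.pullback {f f' : Pt → ℝ} {z z' : C2} (hf : HermAt f z) (T : C2 →ₗ[ℂ] C2)
    (hT : ∀ η, energy f (z, T η) = energy f' (z', η)) : HermAt f' z' := by
  obtain ⟨c, hc⟩ := hf
  refine ⟨fun a b => ∑ i, ∑ j, c i j * T (Pi.single a 1) i * star (T (Pi.single b 1) j),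
    fun η => ?_⟩
  have e : T η = η 0 • T (Pi.single 0 1) + η 1 • T (Pi.single 1 1) := by
    rw [← map_smul, ← map_smul, ← map_add]
    congr 1
    ext i; fin_cases i <;> simp
  rw [← hT, hc, e]
  simp only [Fin.sum_univ_two, Pi.add_apply, Pi.smul_apply, smul_eq_mul, star_add, star_mul']
  ring

/-- Solutions of a linear differential equation with small coefficients. -/
lemma exists_fundamental_solution {V : Type*} [NormedAddCommGroup V] [NormedSpace ℂ V]
    [CompleteSpace V] (B : ℝ → V →L[ℂ] V)
    (hB : ContinuousOn B (Set.Icc 0 1)) (hn : ∀ t ∈ Set.Icc (0 : ℝ) 1, ‖B t‖ ≤ 1 / 3) :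
    ∃ T : ℝ → V →L[ℂ] V, T 0 = .id ℂ V ∧ ∀ t ∈ Set.Icc (0 : ℝ) 1,
      HasDerivWithinAt T ((B t).comp (T t)) (Set.Icc 0 1) t ∧ ∀ x, x ≠ 0 → T t x ≠ 0 := by
  let F : ℝ → (V →L[ℂ] V) → (V →L[ℂ] V) := fun t T => (B t).comp T
  let t₀ : Set.Icc (0 : ℝ) 1 := ⟨0, by simp⟩
  -- On the ball of radius 1/2 about the identity `‖T‖ ≤ 3/2`, so the speed is at most 1/3 · 3/2 =
  -- 1/2 and the solution stays in the ball for unit time. Staying within 1/2 of the identity is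
  -- what gives injectivity below.
  have hF : IsPicardLindelof F t₀ (ContinuousLinearMap.id ℂ V) (1 / 2 : NNReal) 0
      (1 / 2 : NNReal) (1 / 3 : NNReal) := by
    refine ⟨fun t ht => ?_, fun T _ => ?_, fun t ht T hT => ?_, ?_⟩
    · refine LipschitzOnWith.of_dist_le_mul fun T _ T' _ => ?_
      rw [dist_eq_norm, dist_eq_norm, ← ContinuousLinearMap.comp_sub]
      refine (ContinuousLinearMap.opNorm_comp_le _ _).trans ?_
      gcongr
      simpa using hn t ht
    · exact hB.clm_comp continuousOn_const
    · refine (ContinuousLinearMap.opNorm_comp_le _ _).trans ?_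
      have h1 : ‖T‖ ≤ 3 / 2 := by
        have h2 : ‖T - .id ℂ V‖ ≤ 1 / 2 := by simpa [dist_eq_norm] using hT
        have h3 := ContinuousLinearMap.norm_id_le (𝕜 := ℂ) (E := V)
        have h4 := norm_le_norm_sub_add T (.id ℂ V)
        linarith
      have := mul_le_mul (hn t ht) h1 (norm_nonneg _) (by norm_num)
      refine this.trans ?_
      norm_num
    · simp [t₀]
  obtain ⟨α, hα⟩ := ODE.FunSpace.exists_isFixedPt_next hF (Metric.mem_closedBall_self le_rfl)
  refine ⟨α.compProj, ?_, fun t ht => ⟨?_, ?_⟩⟩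
  · have : α.compProj (t₀ : ℝ) = α t₀ := α.compProj_val
    exact this.trans α.apply_of_zero
  · have hmem : ∀ t ∈ Set.Icc (0 : ℝ) 1, α.compProj t ∈
        Metric.closedBall (ContinuousLinearMap.id ℂ V) ((1 / 2 : NNReal) : ℝ) := fun t _ =>
      α.compProj_mem_closedBall hF.mul_max_le
    refine (ODE.hasDerivWithinAt_picard_Icc t₀.2 hF.continuousOn_uncurry
      α.continuous_compProj.continuousOn hmem (ContinuousLinearMap.id ℂ V) ht).congr_of_mem
      (fun s hs => ?_) ht
    rw [← ODE.FunSpace.next_apply hF (Metric.mem_closedBall_self le_rfl) α (t := ⟨s, hs⟩),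
      hα, α.compProj_of_mem hs]
  · intro x hx h0
    have h1 : ‖α.compProj t - .id ℂ V‖ ≤ 1 / 2 := by
      simpa [dist_eq_norm] using α.compProj_mem_closedBall hF.mul_max_le (t := t)
    have h2 := ContinuousLinearMap.le_of_opNorm_le _ h1 x
    rw [sub_apply, h0, ContinuousLinearMap.id_apply, zero_sub, norm_neg] at h2
    have := norm_pos_iff.2 hx
    linarith

lemma hasDerivWithinAt_clm_apply {V : Type*} [NormedAddCommGroup V] [NormedSpace ℂ V]
    {T : ℝ → V →L[ℂ] V} {T' : V →L[ℂ] V} {s : Set ℝ} {t : ℝ} (hT : HasDerivWithinAt T T' s t)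
    (x : V) : HasDerivWithinAt (fun t => T t x) (T' x) s t :=
  ((ContinuousLinearMap.apply ℂ V x).restrictScalars ℝ).hasFDerivAt.comp_hasDerivWithinAt t hT

/-- Matrices as continuous operators. -/
def matCLM : Matrix (Fin 2) (Fin 2) ℂ →ₗ[ℂ] (C2 →L[ℂ] C2) :=
  (LinearMap.toContinuousLinearMap : (C2 →ₗ[ℂ] C2) ≃ₗ[ℂ] _).toLinearMap ∘ₗ
    (Matrix.toLin' : Matrix (Fin 2) (Fin 2) ℂ ≃ₗ[ℂ] _).toLinearMap

lemma matCLM_apply (X : Matrix (Fin 2) (Fin 2) ℂ) (η : C2) : matCLM X η = X.mulVec η := rfl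

lemma continuous_matCLM : Continuous matCLM := LinearMap.continuous_of_finiteDimensional _

/-- The connection matrix in the direction `v`. -/
def connMat (f : Pt → ℝ) (z v : C2) : Matrix (Fin 2) (Fin 2) ℂ :=
  Matrix.of fun i j => -∑ k, Lc f i j k (z, fun _ => 1) * v k

namespace LocalBerwald

variable {f : Pt → ℝ} {Ω : Set C2} (h : LocalBerwald f Ω)
include h

/-- The direction is the horizontal lift of `v`, and `L` is horizontally constant. The reference
vector `(1, 1)` in `connMat` may be replaced by `p.2` because the coefficients depend on z only. -/
lemma fderiv_energy_horizontal {p : Pt} (hp : p ∈ sl Ω) (v : C2) :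
    fderiv ℝ (energy f) p (v, matCLM (connMat f p.1 v) p.2) = 0 := by
  have hq : ((p.1, fun _ => 1) : Pt) ∈ sl Ω := ⟨hp.1, fun h => one_ne_zero (congrFun h 0)⟩
  have h1 : ∀ i, matCLM (connMat f p.1 v) p.2 i = -∑ k, N f i k p * v k := by
    intro i
    have h2 := fun k => h.Lc_eta i k hp
    simp only [matCLM_apply, Matrix.mulVec, dotProduct, connMat, Matrix.of_apply,
      fun i j k => h.indep _ hq p hp rfl i j k, Fin.sum_univ_two] at h2 ⊢
    linear_combination -v 0 * h2 0 - v 1 * h2 1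
  rw [fderiv_eq_wir, wir_I_vec, wir_neg_I_vec]
  simp only [h1, h.dzBar_energy _ hp, h.dvBar_energy _ hp, h.dz_energy _ hp, Fin.sum_univ_two,
    star_add, star_mul', star_neg]
  ring

lemma continuousAt_connMat {z : C2} (hz : z ∈ Ω) (v : C2) :
    ContinuousAt (fun q : C2 × C2 => connMat f q.1 q.2) (z, v) := by
  refine continuousAt_pi.2 fun i => continuousAt_pi.2 fun j => ContinuousAt.neg ?_
  refine tendsto_finsetSum _ fun k _ => ?_
  have hq : ((z, fun _ => 1) : Pt) ∈ sl Ω := ⟨hz, fun h => one_ne_zero (congrFun h 0)⟩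
  have h1 : ContinuousAt (fun q : C2 × C2 => ((q.1, fun _ => 1) : Pt)) (z, v) := by fun_prop
  have h2 : ContinuousAt (fun q : C2 × C2 => q.2 k) (z, v) := by fun_prop
  exact (ContinuousAt.comp (f := fun q : C2 × C2 => ((q.1, fun _ => 1) : Pt))
    (x := (z, v)) ((h.sm_Lc i j k).continuousAt hq) h1).mul h2

/-- The metric is constant along parallel transport. -/
lemma energy_transport {z₀ v : C2} {x : ℝ → C2}
    (hΩ : ∀ t ∈ Set.Icc (0 : ℝ) 1, z₀ + t • v ∈ Ω)
    (hx : ∀ t ∈ Set.Icc (0 : ℝ) 1, HasDerivWithinAt x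
      (matCLM (connMat f (z₀ + t • v) v) (x t)) (Set.Icc 0 1) t)
    (hne : ∀ t ∈ Set.Icc (0 : ℝ) 1, x t ≠ 0) :
    energy f (z₀ + v, x 1) = energy f (z₀, x 0) := by
  let u : ℝ → ℂ := fun t => energy f (z₀ + t • v, x t)
  have hu : ∀ t ∈ Set.Icc (0 : ℝ) 1, HasDerivWithinAt u 0 (Set.Icc 0 1) t := by
    intro t ht
    have hp : ((z₀ + t • v, x t) : Pt) ∈ sl Ω := ⟨hΩ t ht, hne t ht⟩
    have d1 : HasDerivWithinAt (fun t : ℝ => z₀ + t • v) v (Set.Icc 0 1) t := by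
      simpa using (((hasDerivAt_id t).smul_const v).const_add z₀).hasDerivWithinAt
    have d3 := (h.sm_energy.diffAt hp).hasFDerivAt.comp_hasDerivWithinAt t (d1.prodMk (hx t ht))
    exact d3.congr_deriv (h.fderiv_energy_horizontal hp v)
  have := constant_of_derivWithin_zero (f := u) (fun t ht => (hu t ht).differentiableWithinAt)
    (fun t ht => (hu t ⟨ht.1, ht.2.le⟩).derivWithin
      (uniqueDiffOn_Icc zero_lt_one t ⟨ht.1, ht.2.le⟩)) 1 (by simp)
  simpa [u] using this

/-- Nearby fibres are related by injective linear isometries. -/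
lemma exists_isometry {z₀ : C2} (hz₀ : z₀ ∈ Ω) :
    ∀ᶠ z in nhds z₀, ∃ T : C2 →ₗ[ℂ] C2, Function.Injective T ∧
      ∀ η, energy f (z, T η) = energy f (z₀, η) := by
  have hcont : ContinuousAt (fun q : C2 × C2 => matCLM (connMat f q.1 q.2)) (z₀, 0) :=
    continuous_matCLM.continuousAt.comp (h.continuousAt_connMat hz₀ 0)
  have h0 : matCLM (connMat f z₀ 0) = 0 := by
    rw [show connMat f z₀ 0 = 0 by ext i j; simp [connMat], map_zero]
  have hsmall : ∀ᶠ q : C2 × C2 in nhds (z₀, 0),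
      ‖matCLM (connMat f q.1 q.2)‖ < 1 / 3 ∧ q.1 ∈ Ω := by
    refine (hcont.norm.eventually_lt_const (by simp [h0])).and ?_
    exact (h.isOpen.preimage continuous_fst).mem_nhds hz₀
  rw [Metric.eventually_nhds_iff] at hsmall
  obtain ⟨δ, hδ, hs⟩ := hsmall
  refine Metric.eventually_nhds_iff.2 ⟨δ, hδ, fun z hz => ?_⟩
  set v := z - z₀ with hv
  have hball : ∀ t ∈ Set.Icc (0 : ℝ) 1, dist ((z₀ + t • v, v) : C2 × C2) (z₀, 0) < δ := by
    intro t ht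
    rw [dist_eq_norm] at hz
    rw [Prod.dist_eq, max_lt_iff]
    refine ⟨?_, by simpa using hz⟩
    rw [dist_eq_norm, add_sub_cancel_left, norm_smul, Real.norm_of_nonneg ht.1]
    exact (mul_le_of_le_one_left (norm_nonneg _) ht.2).trans_lt hz
  let B : ℝ → C2 →L[ℂ] C2 := fun t => matCLM (connMat f (z₀ + t • v) v)
  have hBc : ContinuousOn B (Set.Icc 0 1) := by
    intro t ht
    refine ContinuousAt.continuousWithinAt (continuous_matCLM.continuousAt.comp ?_)
    exact ContinuousAt.comp (f := fun t : ℝ => ((z₀ + t • v, v) : C2 × C2)) (x := t)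
      (h.continuousAt_connMat (hs (hball t ht)).2 v) (by fun_prop)
  obtain ⟨T, hT0, hT⟩ := exists_fundamental_solution B hBc fun t ht => (hs (hball t ht)).1.le
  have hne : ∀ t ∈ Set.Icc (0 : ℝ) 1, ∀ η, η ≠ 0 → T t η ≠ 0 := fun t ht => (hT t ht).2
  have h1m : (1 : ℝ) ∈ Set.Icc (0 : ℝ) 1 := by simp
  refine ⟨T 1, (injective_iff_map_eq_zero _).2 fun η h0 => ?_, fun η => ?_⟩
  · by_contra hη
    exact hne 1 h1m η hη h0
  have hz1 : z₀ + (1 : ℝ) • v = z := by simp [hv]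
  have hzΩ : z ∈ Ω := hz1 ▸ (hs (hball 1 h1m)).2
  -- The zero vector lies outside the region where `L` is smooth, so it is handled by homogeneity.
  by_cases hη : η = 0
  · have e : ∀ w ∈ Ω, energy f (w, 0) = 0 := by
      intro w hw
      have := h.hom w hw 0 0
      simp only [zero_smul, norm_zero, zero_mul] at this
      simp [energy, this]
    simp [hη, e z hzΩ, e z₀ hz₀]
  have := h.energy_transport (x := fun t => T t η) (fun t ht => (hs (hball t ht)).2)
    (fun t ht => hasDerivWithinAt_clm_apply (hT t ht).1 η) fun t ht => hne t ht η hη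
  rw [show z₀ + v = z by simp [hv], hT0] at this
  exact this

lemma eventually_hermAt_iff {z₀ : C2} (hz₀ : z₀ ∈ Ω) :
    ∀ᶠ z in nhds z₀, (HermAt f z ↔ HermAt f z₀) := by
  filter_upwards [h.exists_isometry hz₀] with z ⟨T, hT, hE⟩
  refine ⟨fun hz => hz.pullback T hE, fun hz => ?_⟩
  let e := LinearEquiv.ofInjectiveEndo T hT
  refine hz.pullback e.symm.toLinearMap fun η => ?_
  rw [← hE]
  congr 2
  exact e.apply_symm_apply η

end LocalBerwald

/-! ### Globalization -/

section Globalization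

variable {M : Type*} [TopologicalSpace M] [ChartedSpace C2 M] [IsManifold 𝓘(ℂ, C2) ω M]
  {F : TangentBundle 𝓘(ℂ, C2) M → ℝ} {x x' : OpenPartialHomeomorph M C2}

lemma IsComplexFinsler.localFinsler (hF : IsComplexFinsler F) (hx : x ∈ charts M) :
    LocalFinsler (loc F x) x.target where
  isOpen := x.open_target
  smooth := hF.smooth x hx
  nonneg p := hF.nonneg _
  hom z _ c η := by
    let L : C2 →L[ℂ] C2 := mfderiv 𝓘(ℂ, C2) 𝓘(ℂ, C2) x.symm z
    exact (congrArg (fun v : C2 => F ⟨x.symm z, v⟩) (L.map_smul c η)).trans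
      (hF.homogeneous (x.symm z) c (L η))
  posDef p hp := hF.posDef x hx p hp

lemma IsBerwald.localBerwald (hB : IsBerwald F) (hF : IsComplexFinsler F) (hx : x ∈ charts M) :
    LocalBerwald (loc F x) x.target where
  toLocalFinsler := hF.localFinsler hx
  kahler p hp := hB.1 x hx p hp
  indep p hp q hq := hB.2 x hx p hp q hq

omit [IsManifold 𝓘(ℂ, C2) ω M] in
lemma mdifferentiable_of_mem_charts (hx : x ∈ charts M) :
    x.MDifferentiable 𝓘(ℂ, C2) 𝓘(ℂ, C2) :=
  ⟨(contMDiffOn_of_mem_maximalAtlas hx).mdifferentiableOn (by simp),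
    (contMDiffOn_symm_of_mem_maximalAtlas hx).mdifferentiableOn (by simp)⟩

omit [IsManifold 𝓘(ℂ, C2) ω M] in
lemma tangentMap_symm_tangentMap (hx : x ∈ charts M) {z : M} (hz : z ∈ x.source)
    (v : TangentSpace 𝓘(ℂ, C2) z) :
    tangentMap 𝓘(ℂ, C2) 𝓘(ℂ, C2) x.symm (tangentMap 𝓘(ℂ, C2) 𝓘(ℂ, C2) x ⟨z, v⟩) = ⟨z, v⟩ := by
  have h1 := congrArg (fun L : TangentSpace 𝓘(ℂ, C2) z →L[ℂ] TangentSpace 𝓘(ℂ, C2) z => L v)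
    ((mdifferentiable_of_mem_charts hx).symm_comp_deriv hz)
  have h2 : ∀ (a b : M) (_ : a = b) (w w' : C2) (_ : w = w'),
      (⟨a, w⟩ : TangentBundle 𝓘(ℂ, C2) M) = ⟨b, w'⟩ := by
    rintro a _ rfl w _ rfl; rfl
  exact h2 _ _ (x.left_inv hz) _ _ h1

omit [IsManifold 𝓘(ℂ, C2) ω M] in
/-- Being Hermitian on a tangent space does not depend on the chart. -/
lemma HermAt.change_chart (hx' : x' ∈ charts M) {z : M} (hz : z ∈ x.source) (hz' : z ∈ x'.source)
    (h : HermAt (loc F x') (x' z)) : HermAt (loc F x) (x z) := by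
  -- The change of fibre coordinates is the differential of the transition map, which is ℂ-linear
  -- and so pulls Hermitian forms back to Hermitian forms.
  let D : C2 →L[ℂ] C2 := mfderiv 𝓘(ℂ, C2) 𝓘(ℂ, C2) x.symm (x z)
  let D' : C2 →L[ℂ] C2 := mfderiv 𝓘(ℂ, C2) 𝓘(ℂ, C2) x' (x.symm (x z))
  let T : C2 →L[ℂ] C2 := D'.comp D
  have hzz := x.left_inv hz
  refine h.pullback T.toLinearMap fun η => ?_
  have h2 := tangentMap_symm_tangentMap hx' (z := x.symm (x z)) (hzz.symm ▸ hz') (D η)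
  have h3 : loc F x' (x' z, T η) = loc F x (x z, η) := by
    have h4 : x' z = x' (x.symm (x z)) := by rw [hzz]
    rw [h4]
    exact congrArg F h2
  exact congrArg (fun r : ℝ => ((r ^ 2 : ℝ) : ℂ)) h3

/-- For a Berwald metric on a connected manifold, one Hermitian tangent space forces all of them
to be Hermitian. -/
lemma hermAt_of_hermAt [ConnectedSpace M] (hF : IsComplexFinsler F) (hB : IsBerwald F)
    (hx : x ∈ charts M) {z z' : M} (hz : z ∈ x.source)
    (hz' : z' ∈ x'.source) (h : HermAt (loc F x) (x z)) : HermAt (loc F x') (x' z') := by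
  have hc : ∀ w : M, chartAt C2 w ∈ charts M := fun w => IsManifold.chart_mem_maximalAtlas w
  let P : M → Prop := fun w => HermAt (loc F (chartAt C2 w)) (chartAt C2 w w)
  have hP : ∀ w, ∀ᶠ y in nhds w, (P y ↔ P w) := by
    intro w
    have hw := mem_chart_source C2 w
    have h1 := ((chartAt C2 w).continuousAt hw).eventually
      ((hB.localBerwald hF (hc w)).eventually_hermAt_iff ((chartAt C2 w).map_source hw))
    filter_upwards [h1, (chartAt C2 w).open_source.mem_nhds hw] with y hy hyw
    refine Iff.trans ?_ hy
    exact ⟨fun h => h.change_chart (hc y) hyw (mem_chart_source C2 y),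
      fun h => h.change_chart (hc w) (mem_chart_source C2 y) hyw⟩
  have hclopen : IsClopen {w | P w} := by
    refine ⟨⟨isOpen_iff_mem_nhds.2 fun w hw => ?_⟩, isOpen_iff_mem_nhds.2 fun w hw => ?_⟩
    · filter_upwards [hP w] with y hy using fun h => hw (hy.1 h)
    · filter_upwards [hP w] with y hy using hy.2 hw
  have huniv := hclopen.eq_univ ⟨z, h.change_chart hx (mem_chart_source C2 z) hz⟩
  have hmem : z' ∈ {w | P w} := huniv ▸ Set.mem_univ z'
  have hPz : P z' := hmem
  exact hPz.change_chart (hc z') hz' (mem_chart_source C2 z')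

end Globalization
end CFinsler

end

/-! ### Conclusion. -/

theorem theorem4p12 {M : Type*} [TopologicalSpace M] [ConnectedSpace M]
    [ChartedSpace CFinsler.C2 M] [IsManifold 𝓘(ℂ, CFinsler.C2) ω M]
    (F : TangentBundle 𝓘(ℂ, CFinsler.C2) M → ℝ)
    (hF : CFinsler.IsComplexFinsler F)
    (hBerwald : CFinsler.IsBerwald F)
    (hSymm : CFinsler.IsWeaklySymmetric F)
    (hA : ∃ x ∈ CFinsler.charts M, ∃ p ∈ CFinsler.slit x, CFinsler.A (CFinsler.loc F x) p ≠ 0) :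
    ∀ x ∈ CFinsler.charts M, ∀ p ∈ CFinsler.slit x,
      (∀ r j h k : Fin 2, CFinsler.R (CFinsler.loc F x) r j h k p = 0) ∧
        CFinsler.K (CFinsler.loc F x) p = 0 ∧ CFinsler.W (CFinsler.loc F x) p = 0 := by
  intro x hx p hp
  have hB := hBerwald.localBerwald hF hx
  have hP : ∀ l m s k, CFinsler.Pc (CFinsler.loc F x) l m s k p = 0 := by
    -- A Hermitian fibre here would force the fibre carrying `A ≠ 0` to be Hermitian. Otherwise the
    -- fibre contains a non-quadratic point `q`, and `P = 0` at `q` carries over to `p`.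
    by_cases hH : CFinsler.HermAt (CFinsler.loc F x) p.1
    · obtain ⟨x₀, hx₀, p₀, hp₀, hA₀⟩ := hA
      have hB₀ := hBerwald.localBerwald hF hx₀
      have h1 := CFinsler.hermAt_of_hermAt hF hBerwald hx (x.map_target hp.1)
        (x₀.map_target hp₀.1) (by rwa [x.right_inv hp.1])
      rw [x₀.right_inv hp₀.1] at h1
      exact absurd (hB₀.A_eq_zero hp₀ (hB₀.L2_eq_zero_of_hermAt hp₀ h1)) hA₀
    · have h1 : ∃ q ∈ CFinsler.nonQuad (CFinsler.loc F x) x.target, q.1 = p.1 := by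
        by_contra! hcon
        refine hH (hB.hermAt_of_L2_eq_zero hp.1 fun q hq hqp k l => ?_)
        by_contra h0
        exact hcon q ⟨hq, k, l, h0⟩ hqp
      obtain ⟨q, hq, hqp⟩ := h1
      intro l m s k
      rw [hB.vertConst_Pc l m s k p hp q hq.1 hqp.symm]
      exact hB.Pc_eq_zero_of_nonQuad (fun r hr => hSymm x hx r hr) hq l m s k
  exact ⟨hB.R_eq_zero hP hp, hB.K_eq_zero hP hp, hB.W_eq_zero hP hp⟩
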